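/- A graph $G$ (finite, simple, undirected) is a trapezoid graph if there are two distinct lines $L_1, L_2$ parallel to the $x$-axis and, for each vertex $v$, a trapezoid $T_v$ with its parallel sides on $L_1$ and $L_2$ (the sides may degenerate to points) such that two distinct vertices $u, v$ are adjacent if and only if $T_u \cap T_v \neq \emptyset$. For a class $\mathcal{C}$ of graphs, the graph isomorphism problem for $\mathcal{C}$ asks, for two given graphs of $\mathcal{C}$ (given by their adjacency matrices), whether they are isomorphic. Corollary. The graph isomorphism problem is GI-complete for trapezoid graphs; that is, the graph isomorphism problem for trapezoid graphs is polynomial-time equivalent to the graph isomorphism problem for general graphs: each of the two problems is reducible to the other by a many-one reduction that a Turing machine computes in polynomial time. -/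

import Mathlib

/-- A decision problem: a set of instances, each written as a string over a finite alphabet
(different instances by different strings), and the set of yes-instances. -/
structure DecisionProblem where
  /-- the instances -/
  Instance : Type
  /-- the alphabet -/
  Symbol : Type
  /-- the alphabet is finite -/
  [symbolFintype : Fintype Symbol]
  /-- the string that describes an instance -/
  encode : Instance → List Symbol
  /-- an instance is determined by its string -/
  encode_injective : Function.Injective encode
  /-- the instances with answer "yes" -/
  Yes : Instance → Prop

/-- Polynomial-time many-one reducibility, for (multi-stack) Turing machines; the running time
is measured in the length of the string that describes the instance. -/
def PolyTimeReducible (P Q : DecisionProblem) : Prop :=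
  ∃ f : P.Instance → Q.Instance,
    Nonempty (Turing.TM2ComputableInPolyTime P.encode Q.encode f) ∧
      ∀ x, P.Yes x ↔ Q.Yes (f x)

/-- Two problems are polynomial-time equivalent if each one reduces to the other. -/
def PolyTimeEquivalent (P Q : DecisionProblem) : Prop :=
  PolyTimeReducible P Q ∧ PolyTimeReducible Q P

/-- Finite simple undirected graphs, on the vertex sets `{0, …, n - 1}`. -/
abbrev FinGraph : Type := Σ n : ℕ, SimpleGraph (Fin n)

open Classical in
/-- The string that describes a graph: the number of vertices in unary (`n` ones and a zero),
then the adjacency matrix, row by row. -/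
noncomputable def encodeGraph (G : FinGraph) : List Bool :=
  List.replicate G.1 true ++ false ::
    (List.ofFn fun i : Fin G.1 => List.ofFn fun j : Fin G.1 => decide (G.2.Adj i j)).flatten

theorem replicate_true_append_inj {m n : ℕ} {s t : List Bool}
    (h : List.replicate m true ++ false :: s = List.replicate n true ++ false :: t) :
    m = n ∧ s = t := by
  induction m generalizing n with
  | zero =>
    cases n with
    | zero => simpa using h
    | succ n => simp [List.replicate_succ] at h
  | succ m ih =>
    cases n with
    | zero => simp [List.replicate_succ] at h
    | succ n =>
      simp only [List.replicate_succ, List.cons_append, List.cons.injEq, true_and] at h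
      simpa using ih h

theorem encodeGraph_injective : Function.Injective encodeGraph := by
  classical
  rintro ⟨m, G⟩ ⟨n, H⟩ h
  obtain ⟨h₁, h₂⟩ := replicate_true_append_inj h
  dsimp only at h₁ h₂
  subst h₁
  have h₃ := List.eq_iff_flatten_eq.2 ⟨h₂, by simp [List.map_ofFn, Function.comp_def]⟩
  have h₄ : G = H := by
    ext i j
    have := List.ofFn_injective (congrFun (List.ofFn_injective h₃) i)
    simpa using congrFun this j
  rw [h₄]

/-- The string that describes a pair of graphs: the two strings one after the other, where the
letters of the first one and of the second one are taken from disjoint copies of the alphabet. -/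
noncomputable def encodePair (p : FinGraph × FinGraph) : List (Bool ⊕ Bool) :=
  (encodeGraph p.1).map Sum.inl ++ (encodeGraph p.2).map Sum.inr

theorem encodePair_injective : Function.Injective encodePair := by
  intro p q h
  have e₁ (l m : List Bool) :
      (l.map Sum.inl ++ m.map Sum.inr : List (Bool ⊕ Bool)).filterMap Sum.getLeft? = l := by
    induction l with
    | nil => induction m <;> simp_all
    | cons x l ih => simpa using ih
  have e₂ (l m : List Bool) :
      (l.map Sum.inl ++ m.map Sum.inr : List (Bool ⊕ Bool)).filterMap Sum.getRight? = m := by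
    induction l with
    | nil => induction m <;> simp_all
    | cons x l ih => exact ih
  have h₁ := congrArg (List.filterMap Sum.getLeft?) h
  have h₂ := congrArg (List.filterMap Sum.getRight?) h
  unfold encodePair at h₁ h₂
  rw [e₁, e₁] at h₁
  rw [e₂, e₂] at h₂
  exact Prod.ext (encodeGraph_injective h₁) (encodeGraph_injective h₂)

/-- The graph isomorphism problem for a class `C` of graphs: given two graphs of the class `C`,
are they isomorphic? -/
noncomputable def graphIsomorphismProblem (C : Set FinGraph) : DecisionProblem where
  Instance := {p : FinGraph × FinGraph // p.1 ∈ C ∧ p.2 ∈ C}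
  Symbol := Bool ⊕ Bool
  encode p := encodePair p.1
  encode_injective := encodePair_injective.comp Subtype.val_injective
  Yes p := Nonempty (p.1.1.2 ≃g p.1.2.2)

/-- The graph isomorphism problem is GI-complete for a class of graphs if the problem for this
class is polynomial-time equivalent to the problem for all graphs. -/
def GIComplete (C : Set FinGraph) : Prop :=
  PolyTimeEquivalent (graphIsomorphismProblem C) (graphIsomorphismProblem Set.univ)

/-- `S` is a trapezoid in the plane with parallel sides on the lines `y = h₁` and `y = h₂`; the
sides may degenerate to points. -/
def IsTrapezoid (h₁ h₂ : ℝ) (S : Set (ℝ × ℝ)) : Prop :=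
  ∃ a b c d : ℝ, a ≤ b ∧ c ≤ d ∧
    S = convexHull ℝ {(a, h₁), (b, h₁), (c, h₂), (d, h₂)}

/-- A trapezoid graph: the intersection graph of a family of trapezoids with parallel sides on
two given distinct lines that are parallel to the `x`-axis. -/
def IsTrapezoidGraph {V : Type*} (G : SimpleGraph V) : Prop :=
  ∃ h₁ h₂ : ℝ, h₁ ≠ h₂ ∧ ∃ T : V → Set (ℝ × ℝ), (∀ v, IsTrapezoid h₁ h₂ (T v)) ∧
    ∀ u v, u ≠ v → (G.Adj u v ↔ (T u ∩ T v).Nonempty)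

/-!
The identity map reduces the problem for trapezoid graphs to the problem for all graphs. For the
converse, a graph `G` on `{0, …, n - 1}` is turned into a trapezoid graph that determines `G`.

Consider the order (`Vert.Below`) with minimal elements `low i`, maximal elements `high j`, all
`low i` below all `high j`, and between `low i` and `high j` one further element if `i` and `j` are
adjacent in `G`, two further elements if `i = j`, and none otherwise. It has interval dimension at
most two (`Vert.below_iff`): in one family of intervals the right ends of the `low i` are sorted by
increasing `i`, in the other one by decreasing `i`. An interval that starts right after the right
end of `low k` in both families is to the right of `low i` in both of them for `i = k` only. The
same works for the left ends of the `high j`. Two trapezoids between two lines are disjoint if and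
only if one of them is to the left of the other one on both lines
(`trapezoid_inter_nonempty_iff`); hence the incomparability graph of the order is a trapezoid graph
(`Vert.isTrapezoidGraph_compl_compGraph`).

The comparability graph determines `G` (`Vert.nonempty_iso_iff`). The minimal and maximal elements
are the vertices with at least three neighbours, and an isomorphism respects the partition of these
vertices into minimal and maximal elements up to an exchange of the two classes, which is induced by
the reversal of the order. The two elements between `low i` and `high i` force the isomorphism to
act on the minimal and on the maximal elements by the same bijection of indices, and this bijection
preserves adjacency. In order that the number of vertices depends on `n` only, an isolated element
is added for each ordered pair that is not adjacent.

It remains to compute the adjacency matrix of the new graph. Programs in a small structured language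
for stack machines (`Prog`) are given a big-step semantics with running times (`Prog.Runs`) and are
compiled to Turing machines (`Prog.machine`, `Prog.Runs.iterate_step`); the alphabets of all stacks
are finite. The rows of the new matrix are written by nested loops in which the elements before and
after the current one are kept on two stacks (`Prog.forEach`), so that a row that is constant except
at the current index is written without any comparison of indices. The output is pushed to a stack,
and so it is produced from its end; this only reverses the sequence of the vertices.
-/

/-! ### Trapezoids between two horizontal lines -/

theorem convexHull_trapezoid_subset {a b c d : ℝ} (hab : a ≤ b) (hcd : c ≤ d) :
    convexHull ℝ {((a, 0) : ℝ × ℝ), (b, 0), (c, 1), (d, 1)} ⊆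
      {p | 0 ≤ p.2 ∧ p.2 ≤ 1 ∧ (1 - p.2) * a + p.2 * c ≤ p.1 ∧
        p.1 ≤ (1 - p.2) * b + p.2 * d} := by
  apply convexHull_min
  · rintro p (rfl | rfl | rfl | rfl) <;> simp [hab, hcd]
  · rintro ⟨x, y⟩ ⟨h₁, h₂, h₃, h₄⟩ ⟨x', y'⟩ ⟨h₁', h₂', h₃', h₄'⟩ s t hs ht hst
    obtain rfl : t = 1 - s := by linarith
    simp only [Prod.smul_mk, smul_eq_mul, Prod.mk_add_mk, Set.mem_ofPred_eq] at *
    refine ⟨by positivity, ?_, ?_, ?_⟩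
    · nlinarith
    · nlinarith [mul_le_mul_of_nonneg_left h₃ hs, mul_le_mul_of_nonneg_left h₃' ht]
    · nlinarith [mul_le_mul_of_nonneg_left h₄ hs, mul_le_mul_of_nonneg_left h₄' ht]

theorem mk_mem_convexHull_of_lines {s : Set (ℝ × ℝ)} {x y t : ℝ} (ht₀ : 0 ≤ t) (ht₁ : t ≤ 1)
    (hx : (x, (0 : ℝ)) ∈ s) (hy : (y, (1 : ℝ)) ∈ s) :
    ((1 - t) * x + t * y, t) ∈ convexHull ℝ s := by
  have := (convex_convexHull ℝ s) (subset_convexHull ℝ s hx) (subset_convexHull ℝ s hy)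
    (sub_nonneg.2 ht₁) ht₀ (by ring)
  simpa using this

theorem mk_mem_convexHull_of_le {s : Set (ℝ × ℝ)} {x y z h : ℝ} (hxz : x ≤ z) (hzy : z ≤ y)
    (hx : (x, h) ∈ s) (hy : (y, h) ∈ s) : (z, h) ∈ convexHull ℝ s := by
  obtain ⟨u, v, hu, hv, huv, rfl⟩ : z ∈ segment ℝ x y := by
    rw [segment_eq_Icc (hxz.trans hzy)]; exact ⟨hxz, hzy⟩
  have := (convex_convexHull ℝ s) (subset_convexHull ℝ s hx) (subset_convexHull ℝ s hy) hu hv huv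
  have e : u * h + v * h = h := by rw [← add_mul, huv, one_mul]
  simpa [e] using this

/-- If the side of the first trapezoid on the line `y = 0` lies to the left of that of the second
one, and on the line `y = 1` it does not, then the trapezoids meet: either on the line `y = 1`, or
where the right leg of the first one crosses the left leg of the second one. -/
theorem trapezoid_inter_nonempty_of_lt {a b c d a' b' c' d' : ℝ}
    (h : b < a') (h' : c' ≤ d) :
    (convexHull ℝ {((a, 0) : ℝ × ℝ), (b, 0), (c, 1), (d, 1)} ∩
      convexHull ℝ {((a', 0) : ℝ × ℝ), (b', 0), (c', 1), (d', 1)}).Nonempty := by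
  have hpos : 0 < (d - c') + (a' - b) := by linarith
  -- the height at which the two legs cross
  set t : ℝ := (a' - b) / ((d - c') + (a' - b)) with ht
  have ht₀ : 0 ≤ t := div_nonneg (by linarith) hpos.le
  have ht₁ : t ≤ 1 := (div_le_one hpos).2 (by linarith)
  have key : (1 - t) * b + t * d = (1 - t) * a' + t * c' := by
    have : t * ((d - c') + (a' - b)) = a' - b := div_mul_cancel₀ _ hpos.ne'
    linarith
  refine ⟨((1 - t) * b + t * d, t), ?_, ?_⟩
  · exact mk_mem_convexHull_of_lines ht₀ ht₁ (by simp) (by simp)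
  · rw [key]
    exact mk_mem_convexHull_of_lines ht₀ ht₁ (by simp) (by simp)

theorem trapezoid_disjoint_of_lt {a b c d a' b' c' d' : ℝ}
    (hab : a ≤ b) (hcd : c ≤ d) (hab' : a' ≤ b') (hcd' : c' ≤ d') (h : b < a') (h' : d < c') :
    ¬ (convexHull ℝ {((a, 0) : ℝ × ℝ), (b, 0), (c, 1), (d, 1)} ∩
      convexHull ℝ {((a', 0) : ℝ × ℝ), (b', 0), (c', 1), (d', 1)}).Nonempty := by
  rintro ⟨⟨x, y⟩, h₁, h₂⟩
  obtain ⟨hy₀, hy₁, -, h₁⟩ := convexHull_trapezoid_subset hab hcd h₁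
  obtain ⟨-, -, h₂, -⟩ := convexHull_trapezoid_subset hab' hcd' h₂
  simp only at *
  rcases hy₀.eq_or_lt with rfl | hy₀
  · linarith
  · nlinarith [mul_le_mul_of_nonneg_left h.le (sub_nonneg.2 hy₁), mul_lt_mul_of_pos_left h' hy₀]

/-- Two trapezoids between the lines `y = 0` and `y = 1` are disjoint if and only if one of them
lies to the left of the other one on both lines. -/
theorem trapezoid_inter_nonempty_iff {a b c d a' b' c' d' : ℝ}
    (hab : a ≤ b) (hcd : c ≤ d) (hab' : a' ≤ b') (hcd' : c' ≤ d') :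
    (convexHull ℝ {((a, 0) : ℝ × ℝ), (b, 0), (c, 1), (d, 1)} ∩
      convexHull ℝ {((a', 0) : ℝ × ℝ), (b', 0), (c', 1), (d', 1)}).Nonempty ↔
      ¬ ((b < a' ∧ d < c') ∨ (b' < a ∧ d' < c)) := by
  constructor
  · rintro h (⟨h₁, h₂⟩ | ⟨h₁, h₂⟩)
    · exact trapezoid_disjoint_of_lt hab hcd hab' hcd' h₁ h₂ h
    · rw [Set.inter_comm] at h
      exact trapezoid_disjoint_of_lt hab' hcd' hab hcd h₁ h₂ h
  · intro h
    rw [not_or, not_and, not_and, not_lt, not_lt] at h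
    rcases lt_or_ge b a' with h₁ | h₁
    · exact trapezoid_inter_nonempty_of_lt h₁ (h.1 h₁)
    rcases lt_or_ge b' a with h₂ | h₂
    · rw [Set.inter_comm]
      exact trapezoid_inter_nonempty_of_lt h₂ (h.2 h₂)
    · refine ⟨(max a a', 0), ?_, ?_⟩
      · exact mk_mem_convexHull_of_le (le_max_left _ _) (max_le hab h₁) (by simp) (by simp)
      · exact mk_mem_convexHull_of_le (le_max_right _ _) (max_le h₂ hab') (by simp) (by simp)

/-- A graph is a trapezoid graph if its non-edges are the pairs of vertices of which one lies to
the left of the other one in each of two families of intervals `[l₀ v, r₀ v]`, `[l₁ v, r₁ v]`. -/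
theorem isTrapezoidGraph_of_intervals {V : Type*} (G : SimpleGraph V) (l₀ r₀ l₁ r₁ : V → ℤ)
    (h₀ : ∀ v, l₀ v ≤ r₀ v) (h₁ : ∀ v, l₁ v ≤ r₁ v)
    (h : ∀ u v, u ≠ v → (G.Adj u v ↔
      ¬ ((r₀ u < l₀ v ∧ r₁ u < l₁ v) ∨ (r₀ v < l₀ u ∧ r₁ v < l₁ u)))) :
    IsTrapezoidGraph G :=
  ⟨0, 1, zero_ne_one,
    fun v => convexHull ℝ {((l₀ v : ℝ), 0), ((r₀ v : ℝ), 0), ((l₁ v : ℝ), 1), ((r₁ v : ℝ), 1)},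
    fun v => ⟨_, _, _, _, mod_cast h₀ v, mod_cast h₁ v, rfl⟩, fun u v huv => by
      rw [h u v huv, trapezoid_inter_nonempty_iff] <;> norm_cast <;> simp only [h₀, h₁]⟩

theorem IsTrapezoidGraph.comap {V W : Type*} {G : SimpleGraph V} (hG : IsTrapezoidGraph G)
    (f : W ↪ V) : IsTrapezoidGraph (G.comap f) := by
  obtain ⟨h₁, h₂, hne, T, hT, h⟩ := hG
  exact ⟨h₁, h₂, hne, T ∘ f, fun v => hT _, fun u v huv => h _ _ (f.injective.ne huv)⟩

/-! ### The order of interval dimension two that encodes a graph -/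

/-- The elements of the order that encodes a graph with vertex set `Fin n`. -/
inductive Vert (n : ℕ) : Type
  /-- the element for the entry `(k, l)` of the adjacency matrix -/
  | mid (k l : Fin n)
  /-- one of the two elements for the `i`-th diagonal entry -/
  | diag (e : Bool) (i : Fin n)
  /-- the minimal element for the vertex `i` -/
  | low (i : Fin n)
  /-- the maximal element for the vertex `i` -/
  | high (i : Fin n)
  deriving DecidableEq

namespace Vert

variable {n m : ℕ}

/-- The strict order that encodes `G`. Every minimal element is below every maximal one, and
strictly between `low k` and `high l` there is one element if `k` and `l` are adjacent, there are
two if `k = l`, and there is none otherwise. The elements `mid k l` for `k` and `l` not adjacent are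
comparable to nothing. -/
def Below (G : SimpleGraph (Fin n)) : Vert n → Vert n → Prop
  | low _, high _ => True
  | low i, mid k l => i = k ∧ G.Adj k l
  | low i, diag _ k => i = k
  | mid k l, high j => j = l ∧ G.Adj k l
  | diag _ k, high j => j = k
  | _, _ => False

/-- The comparability graph of the order that encodes `G`. -/
def compGraph (G : SimpleGraph (Fin n)) : SimpleGraph (Vert n) :=
  SimpleGraph.fromRel (Below G)

/-- Isomorphic graphs are encoded by isomorphic orders. -/
def mapIso {G : SimpleGraph (Fin n)} {H : SimpleGraph (Fin m)} (σ : G ≃g H) :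
    compGraph G ≃g compGraph H where
  toFun
    | mid k l => mid (σ k) (σ l)
    | diag e i => diag e (σ i)
    | low i => low (σ i)
    | high i => high (σ i)
  invFun
    | mid k l => mid (σ.symm k) (σ.symm l)
    | diag e i => diag e (σ.symm i)
    | low i => low (σ.symm i)
    | high i => high (σ.symm i)
  left_inv := by rintro (_ | _ | _ | _) <;> simp
  right_inv := by rintro (_ | _ | _ | _) <;> simp
  map_rel_iff' := by
    rintro (_ | _ | _ | _) (_ | _ | _ | _) <;>
      simp [compGraph, SimpleGraph.fromRel_adj, Below, σ.map_adj_iff]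

/-- Reversing the order exchanges the minimal and the maximal elements. -/
def flip (G : SimpleGraph (Fin n)) : compGraph G ≃g compGraph G where
  toFun
    | mid k l => mid l k
    | diag e i => diag e i
    | low i => high i
    | high i => low i
  invFun
    | mid k l => mid l k
    | diag e i => diag e i
    | low i => high i
    | high i => low i
  left_inv := by rintro (_ | _ | _ | _) <;> simp
  right_inv := by rintro (_ | _ | _ | _) <;> simp
  map_rel_iff' := by
    rintro (_ | _ | _ | _) (_ | _ | _ | _) <;>
      simp [compGraph, SimpleGraph.fromRel_adj, Below, G.adj_comm, and_comm]

/-! ### The order has interval dimension two -/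

section Intervals

variable (G : SimpleGraph (Fin n)) [DecidableRel G.Adj]

/-- Left end of the first interval. An element that is comparable to nothing gets an interval that
meets all other intervals. -/
def l₀ : Vert n → ℤ
  | mid k l => if G.Adj k l then 2 * k - 2 * n + 1 else -3 * n - 3
  | diag _ k => 2 * k - 2 * n + 1
  | low _ => -3 * n - 3
  | high j => 2 * n - 2 * j

/-- Right end of the first interval. -/
def r₀ : Vert n → ℤ
  | mid k l => if G.Adj k l then 2 * n - 2 * l - 1 else 3 * n + 3
  | diag _ l => 2 * n - 2 * l - 1
  | low i => 2 * i - 2 * n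
  | high _ => 3 * n + 3

/-- Left end of the second interval. -/
def l₁ : Vert n → ℤ
  | mid k l => if G.Adj k l then -2 * k - 1 else -3 * n - 3
  | diag _ k => -2 * k - 1
  | low _ => -3 * n - 3
  | high j => 2 * j + 2

/-- Right end of the second interval. -/
def r₁ : Vert n → ℤ
  | mid k l => if G.Adj k l then 2 * l + 1 else 3 * n + 3
  | diag _ l => 2 * l + 1
  | low i => -2 * i - 2
  | high _ => 3 * n + 3

theorem l₀_le_r₀ (v : Vert n) : l₀ G v ≤ r₀ G v := by
  rcases v with _ | _ | _ | _ <;> simp only [l₀, r₀] <;> (try split_ifs) <;> omega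

theorem l₁_le_r₁ (v : Vert n) : l₁ G v ≤ r₁ G v := by
  rcases v with _ | _ | _ | _ <;> simp only [l₁, r₁] <;> (try split_ifs) <;> omega

/-- The two families of intervals realize the order. That `low i` lies to the left of the interval
of `mid k l` means `i ≤ k` in the first family and `k ≤ i` in the second one. -/
theorem below_iff (u v : Vert n) : Below G u v ↔ r₀ G u < l₀ G v ∧ r₁ G u < l₁ G v := by
  rcases u with _ | _ | _ | _ <;> rcases v with _ | _ | _ | _ <;>
    simp only [l₀, l₁, r₀, r₁, Below, Fin.ext_iff] <;> (try split_ifs) <;>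
    (try simp only [*, and_true, and_false, true_iff, false_iff]) <;> omega

end Intervals

variable (G : SimpleGraph (Fin n))

theorem isTrapezoidGraph_compl_compGraph : IsTrapezoidGraph (compGraph G)ᶜ := by
  classical
  refine isTrapezoidGraph_of_intervals _ (l₀ G) (r₀ G) (l₁ G) (r₁ G) (l₀_le_r₀ G) (l₁_le_r₁ G)
    fun u v huv => ?_
  rw [← below_iff, ← below_iff]
  simp [compGraph, huv]

/-! ### The order determines the graph -/

/-- Having at least three neighbours: this distinguishes the minimal and the maximal elements from
the other ones. -/
def Big {V : Type*} (C : SimpleGraph V) (v : V) : Prop :=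
  ∃ x y z, x ≠ y ∧ x ≠ z ∧ y ≠ z ∧ C.Adj v x ∧ C.Adj v y ∧ C.Adj v z

theorem Big.map {V W : Type*} {C : SimpleGraph V} {D : SimpleGraph W} (φ : C ≃g D) {v : V}
    (h : Big C v) : Big D (φ v) := by
  obtain ⟨x, y, z, hxy, hxz, hyz, hx, hy, hz⟩ := h
  exact ⟨φ x, φ y, φ z, by simpa, by simpa, by simpa, by rwa [φ.map_adj_iff],
    by rwa [φ.map_adj_iff], by rwa [φ.map_adj_iff]⟩

theorem big_low (i : Fin n) : Big (compGraph G) (low i) :=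
  ⟨high i, diag false i, diag true i, by simp [compGraph, Below]⟩

theorem big_high (i : Fin n) : Big (compGraph G) (high i) :=
  ⟨low i, diag false i, diag true i, by simp [compGraph, Below]⟩

theorem not_big_mid (k l : Fin n) : ¬ Big (compGraph G) (mid k l) := by
  rintro ⟨_ | _ | _ | _, _ | _ | _ | _, _ | _ | _ | _, h⟩ <;>
    simp [compGraph, Below] at h <;> grind

theorem not_big_diag (e : Bool) (i : Fin n) : ¬ Big (compGraph G) (diag e i) := by
  rintro ⟨_ | _ | _ | _, _ | _ | _ | _, _ | _ | _ | _, h⟩ <;>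
    simp [compGraph, Below] at h <;> grind

variable {G} {H : SimpleGraph (Fin m)}

theorem eq_low_or_eq_high_of_big {v : Vert n} (h : Big (compGraph G) v) :
    ∃ i, v = low i ∨ v = high i := by
  rcases v with ⟨k, l⟩ | ⟨e, i⟩ | i | i
  · exact absurd h (not_big_mid G k l)
  · exact absurd h (not_big_diag G e i)
  · exact ⟨i, .inl rfl⟩
  · exact ⟨i, .inr rfl⟩

/-- An isomorphism is determined on the minimal elements by what it does to one of them. -/
theorem exists_eq_low (φ : compGraph G ≃g compGraph H) {i₀ : Fin n} {j₀ : Fin m}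
    (h : φ (low i₀) = low j₀) (i : Fin n) : ∃ j, φ (low i) = low j := by
  obtain ⟨j, hj | hj⟩ := eq_low_or_eq_high_of_big ((big_low G i).map φ)
  · exact ⟨j, hj⟩
  · have h' : ¬ (compGraph G).Adj (low i) (low i₀) := by simp [compGraph, Below]
    rw [← φ.map_adj_iff, h, hj] at h'
    simp [compGraph, Below] at h'

/-- Maximal elements go to maximal elements if some minimal element goes to a minimal one. -/
theorem exists_eq_high (φ : compGraph G ≃g compGraph H) {i₀ : Fin n} {j₀ : Fin m}
    (h : φ (low i₀) = low j₀) (i : Fin n) : ∃ j, φ (high i) = high j := by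
  obtain ⟨j, hj | hj⟩ := eq_low_or_eq_high_of_big ((big_high G i).map φ)
  · have h' : (compGraph G).Adj (high i) (low i₀) := by simp [compGraph, Below]
    rw [← φ.map_adj_iff, h, hj] at h'
    simp [compGraph, Below] at h'
  · exact ⟨j, hj⟩

/-- Between `low k` and `high l` for `k ≠ l` there is at most one element, and only if `k` and `l`
are adjacent. -/
theorem eq_mid_of_adj {v : Vert n} (hv : ¬ Big (compGraph G) v) {k l : Fin n} (hkl : k ≠ l)
    (hk : (compGraph G).Adj v (low k)) (hl : (compGraph G).Adj v (high l)) :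
    v = mid k l ∧ G.Adj k l := by
  rcases v with ⟨k', l'⟩ | ⟨e, i⟩ | i | i
  · simp only [compGraph, SimpleGraph.fromRel_adj, Below] at hk hl
    grind
  · simp only [compGraph, SimpleGraph.fromRel_adj, Below] at hk hl
    grind
  · exact absurd (big_low G i) hv
  · exact absurd (big_high G i) hv

/-- The elements that are neither minimal nor maximal are mapped to such elements. -/
theorem not_big_map (φ : compGraph G ≃g compGraph H) {v : Vert n} (hv : ¬ Big (compGraph G) v) :
    ¬ Big (compGraph H) (φ v) := fun h => hv (by simpa using h.map φ.symm)

/-- An isomorphism that preserves minimality acts in the same way on the minimal and on the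
maximal elements, because two elements lie between `low i` and `high i`. -/
theorem eq_of_map (φ : compGraph G ≃g compGraph H) {i : Fin n} {j j' : Fin m}
    (h : φ (low i) = low j) (h' : φ (high i) = high j') : j = j' := by
  by_contra hne
  have key (e : Bool) : φ (diag e i) = mid j j' := by
    refine (eq_mid_of_adj (not_big_map φ (not_big_diag G e i)) hne ?_ ?_).1
    · rw [← h, φ.map_adj_iff]; simp [compGraph, Below]
    · rw [← h', φ.map_adj_iff]; simp [compGraph, Below]
  have := φ.injective ((key true).trans (key false).symm)
  simp at this

/-- The image of `mid k l` lies between the images of `low k` and `high l`. -/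
theorem adj_of_map (φ : compGraph G ≃g compGraph H) {k l : Fin n} {k' l' : Fin m}
    (hk : φ (low k) = low k') (hl : φ (high l) = high l') (hne : k' ≠ l') (h : G.Adj k l) :
    H.Adj k' l' := by
  refine (eq_mid_of_adj (not_big_map φ (not_big_mid G k l)) hne ?_ ?_).2
  · rw [← hk, φ.map_adj_iff]; simp [compGraph, Below, h]
  · rw [← hl, φ.map_adj_iff]; simp [compGraph, Below, h]

theorem nonempty_iso_of_map_low (φ : compGraph G ≃g compGraph H) {i₀ : Fin n} {j₀ : Fin m}
    (h₀ : φ (low i₀) = low j₀) : Nonempty (G ≃g H) := by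
  have h₀' : φ.symm (low j₀) = low i₀ := by rw [← h₀, φ.symm_apply_apply]
  choose σ hσ using exists_eq_low φ h₀
  choose τ hτ using exists_eq_high φ h₀
  choose σ' hσ' using exists_eq_low φ.symm h₀'
  choose τ' hτ' using exists_eq_high φ.symm h₀'
  obtain rfl : σ = τ := funext fun i => eq_of_map φ (hσ i) (hτ i)
  obtain rfl : σ' = τ' := funext fun i => eq_of_map φ.symm (hσ' i) (hτ' i)
  have hl (i) : σ' (σ i) = i := by
    have := hσ' (σ i)
    rw [← hσ, φ.symm_apply_apply] at this
    exact (low.inj this).symm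
  have hr (j) : σ (σ' j) = j := by
    have := hσ (σ' j)
    rw [← hσ', φ.apply_symm_apply] at this
    exact (low.inj this).symm
  refine ⟨⟨⟨σ, σ', hl, hr⟩, fun {k l} => ⟨fun h => ?_, fun h => ?_⟩⟩⟩
  · have hne : k ≠ l := by rintro rfl; exact H.irrefl h
    refine adj_of_map φ.symm ?_ ?_ hne h
    · exact (hσ' (σ k)).trans (by rw [hl])
    · exact (hτ' (σ l)).trans (by rw [hl])
  · refine adj_of_map φ (hσ k) (hτ l) (fun e => h.ne ?_) h
    rw [← hl k, show σ k = σ l from e, hl]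

/-- An isomorphism of graphs is an isomorphism of their complements. -/
def complIso {V W : Type*} {C : SimpleGraph V} {D : SimpleGraph W} (φ : C ≃g D) : Cᶜ ≃g Dᶜ :=
  ⟨φ.toEquiv, fun {a b} => by
    have := φ.map_adj_iff (v := a) (w := b)
    simp_all [SimpleGraph.compl_adj]⟩

theorem nonempty_iso_compl_iff {V W : Type*} {C : SimpleGraph V} {D : SimpleGraph W} :
    Nonempty (Cᶜ ≃g Dᶜ) ↔ Nonempty (C ≃g D) := by
  refine ⟨fun ⟨φ⟩ => ?_, fun ⟨φ⟩ => ⟨complIso φ⟩⟩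
  have ψ := complIso φ
  rw [compl_compl, compl_compl] at ψ
  exact ⟨ψ⟩

/-- Graphs are isomorphic if the orders that encode them have isomorphic comparability graphs. -/
theorem nonempty_iso_iff : Nonempty (compGraph G ≃g compGraph H) ↔ Nonempty (G ≃g H) := by
  refine ⟨fun ⟨φ⟩ => ?_, fun ⟨σ⟩ => ⟨mapIso σ⟩⟩
  rcases isEmpty_or_nonempty (Fin n) with hn | ⟨⟨i₀⟩⟩
  -- for `n = 0` there is no minimal element whose image could be looked at
  · have hm : IsEmpty (Fin m) := ⟨fun j => by
      obtain ⟨i, -⟩ := eq_low_or_eq_high_of_big ((big_low H j).map φ.symm)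
      exact hn.false i⟩
    exact ⟨⟨Equiv.equivOfIsEmpty _ _, fun {a} => hn.elim a⟩⟩
  -- if the isomorphism exchanges the two classes, compose it with the reversal of the order
  · obtain ⟨j₀, h | h⟩ := eq_low_or_eq_high_of_big ((big_low G i₀).map φ)
    · exact nonempty_iso_of_map_low φ h
    · exact nonempty_iso_of_map_low (φ.trans (flip H)) (i₀ := i₀) (j₀ := j₀)
        (by rw [RelIso.trans_apply, h]; rfl)

end Vert

/-! ### The encoding of the constructed graph -/

namespace Vert

open List

variable {n : ℕ}

/-- The elements of the order, in the sequence in which the Turing machine treats them. -/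
def verts (n : ℕ) : List (Vert n) :=
  ((finRange n).flatMap fun k => (finRange n).map (mid k)) ++ (finRange n).map (diag false) ++
    (finRange n).map (diag true) ++ (finRange n).map low ++ (finRange n).map high

theorem mem_verts (v : Vert n) : v ∈ verts n := by
  rcases v with _ | ⟨_ | _, _⟩ | _ | _ <;> simp [verts]

theorem nodup_verts (n : ℕ) : (verts n).Nodup := by
  have h (f : Fin n → Vert n) (hf : Function.Injective f) : ((finRange n).map f).Nodup :=
    (nodup_finRange n).map hf
  have h₁ : ((finRange n).flatMap fun k => (finRange n).map (mid k)).Nodup := by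
    rw [nodup_flatMap]
    refine ⟨fun k _ => h _ fun _ _ e => (mid.inj e).2, ?_⟩
    refine (nodup_finRange n).imp ?_
    intro k l hkl
    simp only [Function.onFun, List.Disjoint, mem_map]
    rintro _ ⟨i, -, rfl⟩ ⟨j, -, e⟩
    exact hkl (mid.inj e).1.symm
  have h₂ := h (diag false) fun _ _ e => (diag.inj e).2
  have h₃ := h (diag true) fun _ _ e => (diag.inj e).2
  have h₄ := h low fun _ _ e => low.inj e
  have h₅ := h high fun _ _ e => high.inj e
  simp only [verts, nodup_append', h₁, h₂, h₃, h₄, h₅, List.Disjoint, true_and, mem_append,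
    mem_flatMap, mem_map]
  grind

theorem length_verts (n : ℕ) : (verts n).length = n * n + n + n + n + n := by
  simp [verts, length_flatMap]
  ring

/-- The trapezoid graph that encodes a graph. The vertices are numbered against the sequence
`verts`, because the Turing machine writes its output from the end. -/
noncomputable def trapGraph (G : FinGraph) : FinGraph :=
  ⟨(verts G.1).reverse.length,
    (compGraph G.2)ᶜ.comap ((nodup_reverse.2 (nodup_verts G.1)).getEquivOfForallMemList _
      fun v => mem_reverse.2 (mem_verts v))⟩

theorem isTrapezoidGraph_trapGraph (G : FinGraph) : IsTrapezoidGraph (trapGraph G).2 :=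
  (isTrapezoidGraph_compl_compGraph G.2).comap (Equiv.toEmbedding _)

theorem nonempty_iso_trapGraph_iff (G H : FinGraph) :
    Nonempty ((trapGraph G).2 ≃g (trapGraph H).2) ↔ Nonempty (G.2 ≃g H.2) := by
  refine Iff.trans ?_ (nonempty_iso_compl_iff.trans nonempty_iso_iff)
  have e (G : FinGraph) : (trapGraph G).2 ≃g (compGraph G.2)ᶜ := SimpleGraph.Iso.comap _ _
  exact ⟨fun ⟨φ⟩ => ⟨(e G).symm.trans (φ.trans (e H))⟩,
    fun ⟨φ⟩ => ⟨(e G).trans (φ.trans (e H).symm)⟩⟩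

open Classical in
/-- An entry of the adjacency matrix of a graph, as a truth value. -/
noncomputable def entry {V : Type*} (C : SimpleGraph V) (u v : V) : Bool :=
  decide (C.Adj u v)

theorem entry_eq_true_iff {V : Type*} {C : SimpleGraph V} {u v : V} :
    entry C u v = true ↔ C.Adj u v := by
  classical exact decide_eq_true_iff

theorem entry_comm {V : Type*} (C : SimpleGraph V) (u v : V) : entry C u v = entry C v u := by
  rw [Bool.eq_iff_iff, entry_eq_true_iff, entry_eq_true_iff, C.adj_comm]

/-- The string that describes a graph whose vertices are numbered by their positions in a list. -/
theorem encodeGraph_mk {V : Type*} (C : SimpleGraph V) (vs : List V) (f : Fin vs.length → V)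
    (hf : f = vs.get) :
    encodeGraph ⟨vs.length, C.comap f⟩ =
      replicate vs.length true ++ false :: vs.flatMap fun u => vs.map (entry C u) := by
  subst hf
  have h {β : Type} (g : V → β) : (ofFn fun i => g (vs.get i)) = vs.map g := by
    rw [← Function.comp_def, ← map_ofFn, ofFn_get]
  rw [flatMap_def, ← h (fun u => vs.map (entry C u))]
  simp only [← h]
  rfl

theorem encodeGraph_eq (G : FinGraph) :
    encodeGraph G = replicate G.1 true ++
      false :: (finRange G.1).flatMap fun i => (finRange G.1).map (entry G.2 i) := by
  simp only [encodeGraph, flatMap_def, ofFn_eq_map]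
  rfl

/-- The string that describes the constructed graph, read backwards: this is the sequence in which
the letters are pushed to the output stack. -/
theorem reverse_encodeGraph_trapGraph (G : FinGraph) :
    (encodeGraph (trapGraph G)).reverse =
      ((verts G.1).flatMap fun u => (verts G.1).map (entry (compGraph G.2)ᶜ u)) ++
        false :: replicate (G.1 * G.1 + G.1 + G.1 + G.1 + G.1) true := by
  rw [trapGraph, encodeGraph_mk _ _ _ (by ext; rfl)]
  simp [reverse_flatMap, Function.comp_def, length_verts]

/-! ### The rows of the adjacency matrix -/

section Rows

variable (G : SimpleGraph (Fin n))

theorem entry_compl_compGraph {u v : Vert n} :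
    entry (compGraph G)ᶜ u v = true ↔ u ≠ v ∧ ¬ Below G u v ∧ ¬ Below G v u := by
  rw [entry_eq_true_iff]
  simp only [SimpleGraph.compl_adj, compGraph, SimpleGraph.fromRel_adj]
  tauto

/-- A row of bits all of which but the `i`-th one are set, for a list split at `i`. -/
theorem map_eq_of_split {α : Type*} {l pre post : List α} {i : α} (h : l = pre ++ i :: post)
    (hl : l.Nodup) {f : α → Bool} (hf : ∀ j, j ≠ i → f j = true) :
    l.map f = replicate pre.length true ++ f i :: replicate post.length true := by
  subst h
  rw [nodup_append', nodup_cons] at hl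
  simp only [map_append, map_cons]
  congr 1
  · rw [eq_replicate_iff]
    simp only [length_map, mem_map, true_and]
    rintro _ ⟨j, hj, rfl⟩
    exact hf j fun e => hl.2.2 hj (e ▸ mem_cons_self)
  · congr 1
    rw [eq_replicate_iff]
    simp only [length_map, mem_map, true_and]
    rintro _ ⟨j, hj, rfl⟩
    exact hf j fun e => hl.2.1.1 (e ▸ hj)

/-- A sequence of blocks of `m` bits all of which but those of the `i`-th block are set, for a list
split at `i`. -/
theorem flatMap_eq_of_split {α : Type*} {l pre post : List α} {i : α} (h : l = pre ++ i :: post)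
    (hl : l.Nodup) {f : α → List Bool} {m : ℕ} (hf : ∀ j, j ≠ i → f j = replicate m true) :
    l.flatMap f = replicate (pre.length * m) true ++ f i ++ replicate (post.length * m) true := by
  subst h
  rw [nodup_append', nodup_cons] at hl
  have key : ∀ l : List α, (∀ j ∈ l, f j = replicate m true) →
      l.flatMap f = replicate (l.length * m) true := by
    intro l hl
    induction l with
    | nil => simp
    | cons a l ih =>
      simp only [mem_cons, forall_eq_or_imp] at hl
      rw [flatMap_cons, hl.1, ih hl.2, length_cons, Nat.succ_mul, Nat.add_comm, replicate_add]
  simp only [flatMap_append, flatMap_cons, append_assoc]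
  rw [key pre fun j hj => hf j fun e => hl.2.2 hj (e ▸ mem_cons_self),
    key post fun j hj => hf j fun e => hl.2.1.1 (e ▸ hj)]

theorem map_eq_replicate {α : Type*} {l : List α} {f : α → Bool} {b : Bool}
    (hf : ∀ j, f j = b) : l.map f = replicate l.length b := by
  rw [eq_replicate_iff]
  simp [hf]

/-- The bits of a list all of whose entries but one are set; that one has the value `b`. -/
def oneAt {α β : Type*} (pre : List α) (b : Bool) (post : List β) : List Bool :=
  replicate pre.length true ++ b :: replicate post.length true

variable {pre post pre' post' : List (Fin n)} {i l : Fin n}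

theorem entry_compl_compGraph_eq_false {u v : Vert n} :
    entry (compGraph G)ᶜ u v = false ↔ u = v ∨ Below G u v ∨ Below G v u := by
  rw [← Bool.not_eq_true, entry_compl_compGraph]
  tauto

/-- The row of `mid i l`. The indices before and after `i` are listed in `pre` and `post`, those
before and after `l` in `pre'` and `post'`. -/
theorem row_mid (h : finRange n = pre ++ i :: post) (h' : finRange n = pre' ++ l :: post') :
    (verts n).map (entry (compGraph G)ᶜ (mid i l)) =
      replicate (pre.length * n) true ++ oneAt pre' false post' ++
        replicate (post.length * n) true ++ replicate n true ++ replicate n true ++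
        oneAt pre (!entry G i l) post ++ oneAt pre' (!entry G i l) post' := by
  simp only [verts, map_append, map_flatMap, map_map]
  congr 1; congr 1; congr 1; congr 1
  · rw [flatMap_eq_of_split h (nodup_finRange n) (m := n)]
    · congr 2
      rw [map_eq_of_split h' (nodup_finRange n), oneAt]
      · congr 2
        simp [entry_compl_compGraph_eq_false]
      · intro j hj
        simp [entry_compl_compGraph, Below, hj.symm]
    · intro j hj
      rw [map_eq_replicate (b := true), length_finRange]
      intro k
      simp [entry_compl_compGraph, Below, hj.symm]
  · rw [map_eq_replicate (b := true), length_finRange]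
    simp [entry_compl_compGraph, Below]
  · rw [map_eq_replicate (b := true), length_finRange]
    simp [entry_compl_compGraph, Below]
  · rw [map_eq_of_split h (nodup_finRange n), oneAt]
    · congr 2
      rw [Bool.eq_iff_iff]
      simp [entry_compl_compGraph, Below, ← entry_eq_true_iff]
    · intro j hj
      simp [entry_compl_compGraph, Below, hj]
  · rw [map_eq_of_split h' (nodup_finRange n), oneAt]
    · congr 2
      rw [Bool.eq_iff_iff]
      simp [entry_compl_compGraph, Below, ← entry_eq_true_iff]
    · intro j hj
      simp [entry_compl_compGraph, Below, hj]

theorem row_low (h : finRange n = pre ++ i :: post) :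
    (verts n).map (entry (compGraph G)ᶜ (low i)) =
      replicate (pre.length * n) true ++ ((finRange n).map fun l => !entry G i l) ++
        replicate (post.length * n) true ++ oneAt pre false post ++ oneAt pre false post ++
        oneAt pre false post ++ replicate n false := by
  simp only [verts, map_append, map_flatMap, map_map]
  congr 1; congr 1; congr 1; congr 1
  · rw [flatMap_eq_of_split h (nodup_finRange n) (m := n)]
    · congr 2
      refine map_congr_left fun l _ => ?_
      rw [Bool.eq_iff_iff]
      simp [entry_compl_compGraph, Below, ← entry_eq_true_iff]
    · intro j hj
      rw [map_eq_replicate (b := true), length_finRange]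
      intro k
      simp [entry_compl_compGraph, Below, hj.symm]
  iterate 3
    rw [map_eq_of_split h (nodup_finRange n), oneAt]
    · congr 2
      simp [entry_compl_compGraph_eq_false, Below]
    · intro j hj
      simp [entry_compl_compGraph, Below, hj.symm]
  · rw [map_eq_replicate (b := false), length_finRange]
    simp [entry_compl_compGraph_eq_false, Below]

/-- The symmetry of the adjacency matrix makes the row of `high i` computable from the `i`-th row
of the matrix. -/
theorem row_high (h : finRange n = pre ++ i :: post) :
    (verts n).map (entry (compGraph G)ᶜ (high i)) =
      ((finRange n).flatMap fun k => oneAt pre (!entry G i k) post) ++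
        oneAt pre false post ++ oneAt pre false post ++ replicate n false ++
        oneAt pre false post := by
  simp only [verts, map_append, map_flatMap, map_map]
  congr 1; congr 1; congr 1; congr 1
  · congr 1
    funext k
    rw [map_eq_of_split h (nodup_finRange n), oneAt]
    · congr 2
      rw [Bool.eq_iff_iff]
      simp [entry_compl_compGraph, Below, ← entry_eq_true_iff, entry_comm G k]
    · intro j hj
      simp [entry_compl_compGraph, Below, hj.symm]
  iterate 2
    rw [map_eq_of_split h (nodup_finRange n), oneAt]
    · congr 2
      simp [entry_compl_compGraph_eq_false, Below]
    · intro j hj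
      simp [entry_compl_compGraph, Below, hj.symm]
  · rw [map_eq_replicate (b := false), length_finRange]
    simp [entry_compl_compGraph_eq_false, Below]
  · rw [map_eq_of_split h (nodup_finRange n), oneAt]
    · congr 2
      simp [entry_compl_compGraph_eq_false]
    · intro j hj
      simp [entry_compl_compGraph, Below, hj.symm]

theorem row_diag (e : Bool) (h : finRange n = pre ++ i :: post) :
    (verts n).map (entry (compGraph G)ᶜ (diag e i)) =
      replicate (n * n) true ++
        (bif e then replicate n true ++ oneAt pre false post
          else oneAt pre false post ++ replicate n true) ++
        oneAt pre false post ++ oneAt pre false post := by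
  simp only [verts, map_append, map_flatMap, map_map]
  have h₁ : (finRange n).map (entry (compGraph G)ᶜ (diag e i) ∘ diag (!e)) = replicate n true := by
    rw [map_eq_replicate (b := true), length_finRange]
    simp [entry_compl_compGraph, Below]
  have h₂ : (finRange n).map (entry (compGraph G)ᶜ (diag e i) ∘ diag e) = oneAt pre false post := by
    rw [map_eq_of_split h (nodup_finRange n), oneAt]
    · congr 2
      simp [entry_compl_compGraph_eq_false]
    · intro j hj
      simp [entry_compl_compGraph, Below, hj.symm]
  rw [append_assoc (flatMap _ _)]
  congr 1; congr 1; congr 1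
  · have (k : Fin n) : (finRange n).map (entry (compGraph G)ᶜ (diag e i) ∘ mid k) =
        replicate n true := by
      rw [map_eq_replicate (b := true), length_finRange]
      simp [entry_compl_compGraph, Below]
    simp [this, flatMap_def]
  · cases e
    · rw [cond_false, ← h₁, ← h₂, Bool.not_false]
    · rw [cond_true, ← h₁, ← h₂, Bool.not_true]
  iterate 2
    rw [map_eq_of_split h (nodup_finRange n), oneAt]
    · congr 2
      simp [entry_compl_compGraph_eq_false, Below]
    · intro j hj
      simp [entry_compl_compGraph, Below, hj]

end Rows
end Vert

/-! ### A programming language for stack machines -/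

open Turing

/-- Structured programs for a machine with stacks indexed by `K`, all of them over the alphabet `A`,
and an additional stack for the output, to which one can only push. -/
inductive Prog (K A : Type) : Type
  /-- do nothing -/
  | skip
  /-- push a letter to the output stack -/
  | emit (a : A)
  /-- push a letter to the stack `k` -/
  | push (k : K) (a : A)
  /-- run two programs one after the other -/
  | seq (p q : Prog K A)
  /-- pop from the stack `k`, and run `p` if it was empty and `f a` if the letter `a` was popped -/
  | pop (k : K) (p : Prog K A) (f : A → Prog K A)
  /-- pop letters `a` from the stack `k` and run `f a` for each of them, until the stack is empty
  or a letter with `isLast a` has been popped -/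
  | loop (k : K) (isLast : A → Bool) (f : A → Prog K A)

namespace Prog

variable {K A : Type} [DecidableEq K]

/-- Big-step semantics: `p.Runs S S' o t` says that the program `p`, started with the stacks `S`,
terminates after `t` machine steps with the stacks `S'`, and pushes the letters of `o` to the
output stack, the first one first. -/
inductive Runs : Prog K A → (K → List A) → (K → List A) → List A → ℕ → Prop
  | skip {S} : Runs skip S S [] 1
  | emit {S a} : Runs (emit a) S S [a] 1
  | push {S k a} : Runs (push k a) S (Function.update S k (a :: S k)) [] 1
  | seq {p q S S' S'' o o' t t'} : Runs p S S' o t → Runs q S' S'' o' t' →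
      Runs (seq p q) S S'' (o ++ o') (t + t')
  | pop_nil {k p f S S' o t} : S k = [] → Runs p S S' o t → Runs (pop k p f) S S' o (t + 1)
  | pop_cons {k p f S S' o t a l} : S k = a :: l → Runs (f a) (Function.update S k l) S' o t →
      Runs (pop k p f) S S' o (t + 1)
  | loop_nil {k isLast f S} : S k = [] → Runs (loop k isLast f) S S [] 1
  | loop_last {k isLast f S a l} : S k = a :: l → isLast a = true →
      Runs (loop k isLast f) S (Function.update S k l) [] 1
  | loop_cons {k isLast f S S' S'' o o' t t' a l} : S k = a :: l → isLast a = false →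
      Runs (f a) (Function.update S k l) S' o t → Runs (loop k isLast f) S' S'' o' t' →
      Runs (loop k isLast f) S S'' (o ++ o') (t + t' + 1)

/-! ### Compilation -/

/-- The control states of the machine for a program. -/
def Label : Prog K A → Type
  | skip => Unit
  | emit _ => Unit
  | push _ _ => Unit
  | seq p q => Label p ⊕ Label q
  | pop _ p f => Option (Label p ⊕ Σ a, Label (f a))
  | loop _ _ f => Option (Σ a, Label (f a))

instance finite_label [Finite A] : ∀ p : Prog K A, Finite (Label p)
  | skip => inferInstanceAs (Finite Unit)
  | emit _ => inferInstanceAs (Finite Unit)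
  | push _ _ => inferInstanceAs (Finite Unit)
  | seq p q =>
    have := finite_label p
    have := finite_label q
    inferInstanceAs (Finite (Label p ⊕ Label q))
  | pop _ p f =>
    have := finite_label p
    have := fun a => finite_label (f a)
    inferInstanceAs (Finite (Option (Label p ⊕ Σ a, Label (f a))))
  | loop _ _ f =>
    have := fun a => finite_label (f a)
    inferInstanceAs (Finite (Option (Σ a, Label (f a))))

/-- The control state in which the machine for a program starts. -/
def start : (p : Prog K A) → Label p
  | skip => ()
  | emit _ => ()
  | push _ _ => ()
  | seq p _ => .inl (start p)
  | pop _ _ _ => none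
  | loop _ _ _ => none

/-- The statements of the machine for a program that is part of a larger program with control states
in `Λ`: the control states of the part are embedded by `e`, and `x` is the control state in which
the computation goes on. The internal state holds the letter popped last. The stack `none` is the
output stack. -/
def code {Λ : Type} : (p : Prog K A) → (Label p → Λ) → Λ → Label p →
    TM2.Stmt (fun _ : Option K => A) Λ (Option A)
  | skip, _, x, _ => .goto fun _ => x
  | emit a, _, x, _ => .push none (fun _ => a) (.goto fun _ => x)
  | push k a, _, x, _ => .push (some k) (fun _ => a) (.goto fun _ => x)
  | seq p q, e, _, .inl l => code p (fun l => e (.inl l)) (e (.inr (start q))) l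
  | seq _ q, e, x, .inr l => code q (fun l => e (.inr l)) x l
  | pop k p f, e, _, none => .pop (some k) (fun _ o => o) (.goto fun v => match v with
      | none => e (some (.inl (start p)))
      | some a => e (some (.inr ⟨a, start (f a)⟩)))
  | pop _ p _, e, x, some (.inl l) => code p (fun l => e (some (.inl l))) x l
  | pop _ _ f, e, x, some (.inr ⟨a, l⟩) => code (f a) (fun l => e (some (.inr ⟨a, l⟩))) x l
  | loop k isLast f, e, x, none => .pop (some k) (fun _ o => o) (.goto fun v => match v with
      | none => x
      | some a => if isLast a then x else e (some ⟨a, start (f a)⟩))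
  | loop _ _ f, e, _, some ⟨a, l⟩ => code (f a) (fun l => e (some ⟨a, l⟩)) (e none) l

/-- The stacks of the machine, with the output stack added. -/
def withOutput (S : K → List A) (R : List A) : Option K → List A
  | none => R
  | some k => S k

theorem update_withOutput_none (S : K → List A) (R l : List A) :
    Function.update (withOutput S R) none l = withOutput S l := by
  ext1 k; cases k <;> simp [withOutput]

theorem update_withOutput_some (S : K → List A) (R l : List A) (k : K) :
    Function.update (withOutput S R) (some k) l = withOutput (Function.update S k l) R := by
  ext1 k'
  cases k' with
  | none => simp [withOutput]
  | some k' => by_cases h : k' = k <;> simp [withOutput, Function.update, h]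

/-- The machine simulates the program. -/
theorem Runs.iterate_step {p : Prog K A} {S S' : K → List A} {o : List A} {t : ℕ}
    (h : p.Runs S S' o t) {Λ : Type} (M : Λ → TM2.Stmt (fun _ : Option K => A) Λ (Option A))
    (e : Label p → Λ) (x : Λ) (he : ∀ l, M (e l) = code p e x l) (R : List A) (v : Option A) :
    ∃ v', (_root_.flip bind (TM2.step M))^[t] (some ⟨some (e (start p)), v, withOutput S R⟩) =
      some ⟨some x, v', withOutput S' (o.reverse ++ R)⟩ := by
  induction h generalizing Λ M x R v with
  | skip => exact ⟨v, by simp [_root_.flip, he, code]⟩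
  | emit => exact ⟨v, by simp [_root_.flip, he, code, update_withOutput_none, withOutput]⟩
  | push => exact ⟨v, by simp [_root_.flip, he, code, update_withOutput_some, withOutput]⟩
  | @seq p q S S' S'' o o' t t' _ _ ih₁ ih₂ =>
    obtain ⟨v₁, h₁⟩ := ih₁ M (fun l => e (.inl l)) (e (.inr (start q))) (fun l => he (.inl l)) R v
    obtain ⟨v₂, h₂⟩ := ih₂ M (fun l => e (.inr l)) x (fun l => he (.inr l)) (o.reverse ++ R) v₁
    refine ⟨v₂, ?_⟩
    rw [add_comm, Function.iterate_add_apply]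
    refine (congrArg _ h₁).trans (h₂.trans ?_)
    simp
  | @pop_nil k p f S S' o t hk _ ih =>
    obtain ⟨v₁, h₁⟩ := ih M (fun l => e (some (.inl l))) x (fun l => he (some (.inl l))) R none
    refine ⟨v₁, ?_⟩
    rw [Function.iterate_succ_apply]
    refine Eq.trans (congrArg _ ?_) h₁
    have : Function.update S k [] = S := by rw [← hk, Function.update_eq_self]
    have hM := he none
    simp [_root_.flip, start, hM, code, update_withOutput_some, withOutput, hk, this]
  | @pop_cons k p f S S' o t a l hk _ ih =>
    obtain ⟨v₁, h₁⟩ := ih M (fun l => e (some (.inr ⟨a, l⟩))) x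
      (fun l => he (some (.inr ⟨a, l⟩))) R (some a)
    refine ⟨v₁, ?_⟩
    rw [Function.iterate_succ_apply]
    refine Eq.trans (congrArg _ ?_) h₁
    have hM := he none
    simp [_root_.flip, start, hM, code, update_withOutput_some, withOutput, hk]
  | @loop_nil k isLast f S hk =>
    refine ⟨none, ?_⟩
    have : Function.update S k [] = S := by rw [← hk, Function.update_eq_self]
    have hM := he none
    simp [_root_.flip, start, hM, code, update_withOutput_some, withOutput, hk, this]
  | @loop_last k isLast f S a l hk hs =>
    refine ⟨some a, ?_⟩
    have hM := he none
    simp [_root_.flip, start, hM, code, update_withOutput_some, withOutput, hk, hs]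
  | @loop_cons k isLast f S S' S'' o o' t t' a l hk hs _ _ ih₁ ih₂ =>
    obtain ⟨v₁, h₁⟩ := ih₁ M (fun l => e (some ⟨a, l⟩)) (e none)
      (fun l => he (some ⟨a, l⟩)) R (some a)
    obtain ⟨v₂, h₂⟩ := ih₂ M e x he (o.reverse ++ R) v₁
    refine ⟨v₂, ?_⟩
    rw [Function.iterate_succ_apply, add_comm, Function.iterate_add_apply]
    refine Eq.trans (congrArg _ ?_) (h₂.trans (by simp))
    refine Eq.trans (congrArg _ ?_) h₁
    have hM := he none
    simp [_root_.flip, start, hM, code, update_withOutput_some, withOutput, hk, hs]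

/-- The Turing machine for a program, with input stack `k₀`. -/
noncomputable def machine [Fintype K] [Fintype A] (p : Prog K A) (k₀ : K) : FinTM2 where
  K := Option K
  k₀ := some k₀
  k₁ := none
  Γ _ := A
  Λ := Option (Label p)
  main := some (start p)
  ΛFin := Fintype.ofFinite _
  σ := Option A
  initialState := none
  m
    | none => .load (fun _ => none) .halt
    | some l => code p some none l

/-- A program that consumes its input and leaves nothing but its output. -/
noncomputable def Runs.outputsInTime [Fintype K] [Fintype A] {p : Prog K A} {k₀ : K}
    {s o : List A} {t T : ℕ} (h : p.Runs (Function.update (fun _ => []) k₀ s) (fun _ => []) o t)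
    (hT : t + 1 ≤ T) :
    TM2OutputsInTime (machine p k₀) s (some o.reverse) T where
  steps := t + 1
  steps_le_m := hT
  evals_in_steps := by
    -- one more step resets the internal state, as the definition of an output requires
    obtain ⟨v, hv⟩ := h.iterate_step (machine p k₀).m some none (fun l => rfl) [] none
    have h₁ : initList (machine p k₀) s = ⟨some (some (start p)), none,
        withOutput (Function.update (fun _ => []) k₀ s) []⟩ := by
      unfold initList
      congr 1
      funext k
      rcases k with _ | k
      · exact dif_neg (by simp [machine])
      · by_cases hk : k = k₀
        · subst hk
          refine (dif_pos rfl).trans ?_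
          simp only [withOutput, Function.update_self]
          rfl
        · refine (dif_neg (by simpa [machine] using hk)).trans ?_
          simp only [withOutput, Function.update_of_ne hk]
          rfl
    have h₂ : haltList (machine p k₀) o.reverse = ⟨none, none,
        withOutput (fun _ => []) o.reverse⟩ := by
      unfold haltList
      congr 1
      funext k
      rcases k with _ | k
      · exact dif_pos rfl
      · exact dif_neg (by simp [machine])
    rw [Function.iterate_succ_apply', h₁]
    rw [List.append_nil] at hv
    exact (congrArg _ hv).trans (congrArg some h₂.symm)

/-! ### Loops -/

/-- The program `p`, started with the stacks `S`, terminates after at most `T` machine steps with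
the stacks `S'`, and pushes the letters of `o` to the output stack. -/
def RunsIn (p : Prog K A) (S S' : K → List A) (o : List A) (T : ℕ) : Prop :=
  ∃ t ≤ T, p.Runs S S' o t

theorem RunsIn.seq {p q : Prog K A} {S S' S'' : K → List A} {o o' : List A} {T T' : ℕ}
    (h : RunsIn p S S' o T) (h' : RunsIn q S' S'' o' T') :
    RunsIn (p.seq q) S S'' (o ++ o') (T + T') := by
  obtain ⟨t, ht, h⟩ := h
  obtain ⟨t', ht', h'⟩ := h'
  exact ⟨t + t', by omega, h.seq h'⟩

theorem RunsIn.congr {p : Prog K A} {S S₁ S' S₁' : K → List A} {o o₁ : List A} {T T₁ : ℕ}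
    (h : RunsIn p S S' o T) (hS : S = S₁) (hS' : S' = S₁') (ho : o = o₁) (hT : T ≤ T₁) :
    RunsIn p S₁ S₁' o₁ T₁ := by
  subst hS hS' ho
  obtain ⟨t, ht, h⟩ := h
  exact ⟨t, ht.trans hT, h⟩

theorem runsIn_skip {S : K → List A} : RunsIn skip S S [] 1 := ⟨1, le_rfl, .skip⟩

theorem runsIn_emit {S : K → List A} (a : A) : RunsIn (emit a) S S [a] 1 := ⟨1, le_rfl, .emit⟩

theorem runsIn_push {S : K → List A} (k : K) (a : A) :
    RunsIn (push k a) S (Function.update S k (a :: S k)) [] 1 := ⟨1, le_rfl, .push⟩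

theorem RunsIn.pop {k : K} {p : Prog K A} {f : A → Prog K A} {S S' : K → List A} {o l : List A}
    {a : A} {T : ℕ} (hS : S k = a :: l) (h : RunsIn (f a) (Function.update S k l) S' o T) :
    RunsIn (pop k p f) S S' o (T + 1) := by
  obtain ⟨t, ht, h⟩ := h
  exact ⟨t + 1, by omega, .pop_cons hS h⟩

/-- The rule for loops. The stack of the loop holds the letters `g i` for `i` in a list `L`, and
`St pre post` are the stacks when the part `pre` of `L` has been treated and the part `post` has
not. -/
theorem runsIn_loop {ι : Type*} {k : K} {isLast : A → Bool} {f : A → Prog K A} (g : ι → A)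
    (L : List ι) (St : List ι → List ι → K → List A) (out : ι → List A) (c : ℕ)
    (hlast : ∀ i ∈ L, isLast (g i) = false)
    (hst : ∀ pre post, L = pre ++ post → St pre post k = post.map g)
    (hf : ∀ pre i post, L = pre ++ i :: post →
      RunsIn (f (g i)) (Function.update (St pre (i :: post)) k (post.map g))
        (St (pre ++ [i]) post) (out i) c) :
    RunsIn (loop k isLast f) (St [] L) (St L []) (L.flatMap out) (L.length * (c + 1) + 1) := by
  suffices h : ∀ post pre, L = pre ++ post → RunsIn (loop k isLast f) (St pre post) (St L [])
      (post.flatMap out) (post.length * (c + 1) + 1) from h L [] rfl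
  intro post
  induction post with
  | nil =>
    intro pre h
    rw [List.append_nil] at h
    subst h
    exact ⟨1, by simp, .loop_nil (by simp [hst])⟩
  | cons i post ih =>
    intro pre h
    obtain ⟨t, ht, hr⟩ := hf pre i post h
    obtain ⟨t', ht', hr'⟩ := ih (pre ++ [i]) (by simp [h])
    refine ⟨t + t' + 1, ?_, .loop_cons (by rw [hst _ _ h]; rfl) (hlast i (by simp [h])) hr hr'⟩
    rw [List.length_cons, Nat.succ_mul]
    omega

/-- Move the letters of the stack `k` to the stack `k'`, one after the other. -/
def move (k k' : K) : Prog K A := loop k (fun _ => false) (push k')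

theorem runsIn_move {k k' : K} (hk : k ≠ k') (S : K → List A) :
    RunsIn (move k k') S
      (Function.update (Function.update S k []) k' ((S k).reverse ++ S k')) []
      (2 * (S k).length + 1) := by
  have := runsIn_loop (k := k) (isLast := fun _ => false) (f := push k') id (S k)
    (fun pre post => Function.update (Function.update S k post) k' (pre.reverse ++ S k'))
    (fun _ => []) 1 (fun _ _ => rfl) (fun pre post h => by simp [hk]) (fun pre i post h => by
      refine (runsIn_push k' i).congr rfl ?_ rfl le_rfl
      ext1 x
      by_cases h₁ : x = k' <;> by_cases h₂ : x = k <;> simp_all [Function.update])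
  exact this.congr (by simp) rfl (by simp) (by omega)

/-- Run `f a` for each letter `a` of the stack `k`, while these letters are moved to the stack `k'`,
and move them back. While `f a` runs, the letters before and after `a` are on the two stacks. -/
def forEach (k k' : K) (f : A → Prog K A) : Prog K A :=
  (loop k (fun _ => false) fun a => (f a).seq (push k' a)).seq (move k' k)

/-- A time bound for `forEach` if the body runs `m` times and takes time `c`. -/
def forEachTime {R : Type*} [Semiring R] (m c : R) : R := m * (c + 4) + 2

theorem forEachTime_mono {m m' c c' : ℕ} (hm : m ≤ m') (hc : c ≤ c') :
    forEachTime m c ≤ forEachTime m' c' := by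
  unfold forEachTime
  gcongr

/-- The rule for `forEach`. Except for `k` and `k'`, the stacks are those of `F pre post` when the
part `pre` of the list `L` has been treated and the part `post` has not. -/
theorem runsIn_forEach {ι : Type*} {k k' : K} (hk : k ≠ k') {f : A → Prog K A} (g : ι → A)
    (L : List ι) (F : List ι → List ι → K → List A) (out : ι → List A) (c : ℕ)
    (hf : ∀ pre i post, L = pre ++ i :: post →
      RunsIn (f (g i))
        (Function.update (Function.update (F pre (i :: post)) k (post.map g)) k'
          (pre.map g).reverse)
        (Function.update (Function.update (F (pre ++ [i]) post) k (post.map g)) k'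
          (pre.map g).reverse) (out i) c) :
    RunsIn (forEach k k' f)
      (Function.update (Function.update (F [] L) k (L.map g)) k' [])
      (Function.update (Function.update (F L []) k (L.map g)) k' [])
      (L.flatMap out) (forEachTime L.length c) := by
  have h₁ := runsIn_loop (k := k) (isLast := fun _ => false) (f := fun a => (f a).seq (push k' a))
    g L (fun pre post => Function.update (Function.update (F pre post) k (post.map g)) k'
      (pre.map g).reverse) out (c + 1) (fun _ _ => rfl) (fun pre post h => by simp [hk])
    (fun pre i post h => by
      refine ((hf pre i post h).seq (runsIn_push k' (g i))).congr ?_ ?_ (by simp) le_rfl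
      · ext1 x
        by_cases h₁ : x = k' <;> by_cases h₂ : x = k <;> simp_all [Function.update]
      · simp)
  refine (h₁.seq (runsIn_move hk.symm _)).congr (by simp) ?_ (by simp) ?_
  · ext1 x
    by_cases h₁ : x = k' <;> by_cases h₂ : x = k <;> simp_all [Function.update]
  · simp only [Function.update_self, List.length_reverse, List.length_map, forEachTime]
    linarith

/-- The rule for `forEach` if the body changes no stack. -/
theorem runsIn_forEach_const {ι : Type*} {k k' : K} (hk : k ≠ k') {f : A → Prog K A} (g : ι → A)
    (L : List ι) (S : K → List A) (hS : S k = L.map g) (hS' : S k' = []) (out : ι → List A) (c : ℕ)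
    (hf : ∀ pre i post, L = pre ++ i :: post →
      RunsIn (f (g i))
        (Function.update (Function.update S k (post.map g)) k' (pre.map g).reverse)
        (Function.update (Function.update S k (post.map g)) k' (pre.map g).reverse) (out i) c) :
    RunsIn (forEach k k' f) S S (L.flatMap out) (forEachTime L.length c) := by
  have e : Function.update (Function.update S k (L.map g)) k' [] = S := by
    rw [← hS, ← hS']
    simp
  exact (runsIn_forEach hk g L (fun _ _ => S) out c hf).congr e e rfl le_rfl

/-- Empty the stack `k`. -/
def clear (k : K) : Prog K A := loop k (fun _ => false) fun _ => skip

theorem runsIn_clear (k : K) (S : K → List A) :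
    RunsIn (clear k) S (Function.update S k []) [] (2 * (S k).length + 1) := by
  refine (runsIn_loop (k := k) id (S k) (fun _ post => Function.update S k post)
    (fun _ => []) 1 (fun _ _ => rfl) (fun pre post h => by simp)
    (fun pre i post h => ?_)).congr (by simp) rfl (by simp) (by omega)
  exact runsIn_skip.congr (by simp) rfl rfl le_rfl

end Prog

/-! ### The program for the reduction -/

/-- The letters of the string that describes a pair of graphs. -/
abbrev Letter : Type := Bool ⊕ Bool

/-- The bit that a letter stands for. -/
def Letter.bit : Letter → Bool := Sum.elim id id

/-- The stacks of the machine: the input; the strings of the two graphs; the adjacency matrix of one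
of them; two copies of its number of vertices in unary; a row of the matrix; a stack for scratch.
A primed stack receives the letters of the unprimed one while a loop runs through the latter. -/
inductive Stack : Type
  | input | fst | snd | mat | mat' | cnt | cnt' | cyc | cyc' | row | row' | tmp
  deriving DecidableEq

instance : Fintype Stack where
  elems := {.input, .fst, .snd, .mat, .mat', .cnt, .cnt', .cyc, .cyc', .row, .row', .tmp}
  complete k := by cases k <;> decide

/-- The contents of all stacks. -/
structure Store : Type where
  (input fst snd mat mat' cnt cnt' cyc cyc' row row' tmp : List Letter)

namespace Store

/-- The content of a stack. -/
def get (s : Store) : Stack → List Letter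
  | .input => s.input
  | .fst => s.fst
  | .snd => s.snd
  | .mat => s.mat
  | .mat' => s.mat'
  | .cnt => s.cnt
  | .cnt' => s.cnt'
  | .cyc => s.cyc
  | .cyc' => s.cyc'
  | .row => s.row
  | .row' => s.row'
  | .tmp => s.tmp

variable (s : Store) (l : List Letter)

@[simp] theorem update_input : Function.update s.get .input l = { s with input := l }.get := by
  funext k; cases k <;> rfl

@[simp] theorem update_fst : Function.update s.get .fst l = { s with fst := l }.get := by
  funext k; cases k <;> rfl

@[simp] theorem update_snd : Function.update s.get .snd l = { s with snd := l }.get := by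
  funext k; cases k <;> rfl

@[simp] theorem update_mat : Function.update s.get .mat l = { s with mat := l }.get := by
  funext k; cases k <;> rfl

@[simp] theorem update_mat' : Function.update s.get .mat' l = { s with mat' := l }.get := by
  funext k; cases k <;> rfl

@[simp] theorem update_cnt : Function.update s.get .cnt l = { s with cnt := l }.get := by
  funext k; cases k <;> rfl

@[simp] theorem update_cnt' : Function.update s.get .cnt' l = { s with cnt' := l }.get := by
  funext k; cases k <;> rfl

@[simp] theorem update_cyc : Function.update s.get .cyc l = { s with cyc := l }.get := by
  funext k; cases k <;> rfl

@[simp] theorem update_cyc' : Function.update s.get .cyc' l = { s with cyc' := l }.get := by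
  funext k; cases k <;> rfl

@[simp] theorem update_row : Function.update s.get .row l = { s with row := l }.get := by
  funext k; cases k <;> rfl

@[simp] theorem update_row' : Function.update s.get .row' l = { s with row' := l }.get := by
  funext k; cases k <;> rfl

/-- No stack is higher than `B`. -/
def Bounded (B : ℕ) : Prop := ∀ k, (s.get k).length ≤ B

end Store

namespace Prog

open List Vert

variable {B : ℕ} {s : Store} (tag : Bool → Letter)

/-- For each letter of the stack `k`, push the bit `b` to the output stack. -/
def emitLen (b : Bool) (k : Stack) : Prog Stack Letter := forEach k .tmp fun _ => emit (tag b)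

/-- A time bound for `emitLen`. -/
def emitTime {R : Type*} [Semiring R] (B : R) : R := forEachTime B 1

theorem runsIn_emitLen (hs : s.Bounded B) (ht : s.tmp = []) (b : Bool) (k : Stack)
    (hk : k ≠ .tmp := by decide) :
    RunsIn (emitLen tag b k) s.get s.get ((replicate (s.get k).length b).map tag) (emitTime B) := by
  refine (runsIn_forEach_const (A := Letter) hk id (s.get k) s.get (by simp) ht
    (fun _ => [tag b]) 1 fun pre i post h => runsIn_emit (tag b)).congr rfl rfl ?_
    (forEachTime_mono (hs k) le_rfl)
  simp [flatMap_def]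

/-- Push a row of bits to the output stack, all of which but one are set. -/
def emitOneAt (k' : Stack) (b : Bool) (k : Stack) : Prog Stack Letter :=
  (emitLen tag true k').seq ((emit (tag b)).seq (emitLen tag true k))

theorem runsIn_emitOneAt (hs : s.Bounded B) (ht : s.tmp = []) (k' : Stack) (b : Bool) (k : Stack)
    (hk' : k' ≠ .tmp := by decide) (hk : k ≠ .tmp := by decide) :
    RunsIn (emitOneAt tag k' b k) s.get s.get ((oneAt (s.get k') b (s.get k)).map tag)
      (3 * emitTime B) := by
  refine ((runsIn_emitLen tag hs ht true k' hk').seq ((runsIn_emit (tag b)).seq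
    (runsIn_emitLen tag hs ht true k hk))).congr rfl rfl (by simp [oneAt]) ?_
  have : 1 ≤ emitTime B := by unfold emitTime forEachTime; omega
  omega

/-- Push the row of `mid i l` to the output stack. The entries before and after the `(i, l)`-th one
of the matrix are on the stacks `mat'`, `row'` and `row`, `mat`. The entry itself is `b`. -/
def midRow (b : Bool) : Prog Stack Letter :=
  (emitLen tag true .mat').seq <| (emitOneAt tag .row' false .row).seq <|
    (emitLen tag true .mat).seq <| (emitLen tag true .cyc).seq <| (emitLen tag true .cyc).seq <|
    (emitOneAt tag .cnt' (!b) .cnt).seq (emitOneAt tag .row' (!b) .row)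

theorem runsIn_midRow (hs : s.Bounded B) (ht : s.tmp = []) (b : Bool) :
    RunsIn (midRow tag b) s.get s.get
      ((replicate s.mat'.length true ++ oneAt s.row' false s.row ++
        replicate s.mat.length true ++ replicate s.cyc.length true ++
        replicate s.cyc.length true ++ oneAt s.cnt' (!b) s.cnt ++ oneAt s.row' (!b) s.row).map tag)
      (13 * emitTime B) := by
  refine ((runsIn_emitLen tag hs ht true .mat').seq <|
    (runsIn_emitOneAt tag hs ht .row' false .row).seq <|
    (runsIn_emitLen tag hs ht true .mat).seq <| (runsIn_emitLen tag hs ht true .cyc).seq <|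
    (runsIn_emitLen tag hs ht true .cyc).seq <| (runsIn_emitOneAt tag hs ht .cnt' (!b) .cnt).seq
    (runsIn_emitOneAt tag hs ht .row' (!b) .row)).congr rfl rfl ?_ (by omega)
  simp [Store.get, -replicate_append_replicate]

/-- Push the row of `low i` to the output stack. -/
def lowRow : Prog Stack Letter :=
  (emitLen tag true .mat').seq <| (forEach .row .row' fun a => emit (tag !a.bit)).seq <|
    (emitLen tag true .mat).seq <| (emitOneAt tag .cnt' false .cnt).seq <|
    (emitOneAt tag .cnt' false .cnt).seq <| (emitOneAt tag .cnt' false .cnt).seq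
    (emitLen tag false .cyc)

theorem runsIn_lowRow (hs : s.Bounded B) (ht : s.tmp = []) (hr : s.row' = []) :
    RunsIn (lowRow tag) s.get s.get
      ((replicate s.mat'.length true ++ s.row.map (fun a => !a.bit) ++
        replicate s.mat.length true ++ oneAt s.cnt' false s.cnt ++ oneAt s.cnt' false s.cnt ++
        oneAt s.cnt' false s.cnt ++ replicate s.cyc.length false).map tag)
      (13 * emitTime B) := by
  have h : RunsIn (forEach .row .row' fun a => emit (tag !a.bit)) s.get s.get
      ((s.row.map (fun a => !a.bit)).map tag) (emitTime B) := by
    refine (runsIn_forEach_const (k := .row) (k' := .row')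
      (f := fun a => emit (tag !a.bit)) (by decide) id s.row s.get (by simp [Store.get])
      (by exact hr) (fun a => [tag !a.bit]) 1 fun pre a post h =>
        runsIn_emit (tag !a.bit)).congr rfl rfl ?_
      (forEachTime_mono (hs .row) le_rfl)
    simp [← map_eq_flatMap]
  refine ((runsIn_emitLen tag hs ht true .mat').seq <| h.seq <|
    (runsIn_emitLen tag hs ht true .mat).seq <| (runsIn_emitOneAt tag hs ht .cnt' false .cnt).seq <|
    (runsIn_emitOneAt tag hs ht .cnt' false .cnt).seq <|
    (runsIn_emitOneAt tag hs ht .cnt' false .cnt).seq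
    (runsIn_emitLen tag hs ht false .cyc)).congr rfl rfl ?_ (by omega)
  simp [Store.get]

/-- Push the row of `high i` to the output stack. -/
def highRow : Prog Stack Letter :=
  (forEach .row .row' fun a => emitOneAt tag .cnt' (!a.bit) .cnt).seq <|
    (emitOneAt tag .cnt' false .cnt).seq <| (emitOneAt tag .cnt' false .cnt).seq <|
    (emitLen tag false .cyc).seq (emitOneAt tag .cnt' false .cnt)

/-- Splitting a stack in two does not make it higher. -/
theorem bounded_split_row (hs : s.Bounded B) {pre post : List Letter} {a : Letter}
    (h : s.row = pre ++ a :: post) :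
    Store.Bounded { s with row := post, row' := pre.reverse } B := by
  have h₁ := hs .row
  intro k
  have h₂ := hs k
  cases k <;> simp [Store.get, h] at h₁ h₂ ⊢ <;> omega

theorem runsIn_highRow (hs : s.Bounded B) (ht : s.tmp = []) (hr : s.row' = []) :
    RunsIn (highRow tag) s.get s.get
      ((s.row.flatMap (fun a => oneAt s.cnt' (!a.bit) s.cnt) ++ oneAt s.cnt' false s.cnt ++
        oneAt s.cnt' false s.cnt ++ replicate s.cyc.length false ++
        oneAt s.cnt' false s.cnt).map tag)
      (forEachTime B (3 * emitTime B) + 10 * emitTime B) := by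
  have h : RunsIn (forEach .row .row' fun a => emitOneAt tag .cnt' (!a.bit) .cnt) s.get s.get
      ((s.row.flatMap (fun a => oneAt s.cnt' (!a.bit) s.cnt)).map tag)
      (forEachTime B (3 * emitTime B)) := by
    refine (runsIn_forEach_const (k := .row) (k' := .row') (by decide) id s.row s.get
      (by simp [Store.get]) (by exact hr) (fun a => (oneAt s.cnt' (!a.bit) s.cnt).map tag)
      (3 * emitTime B) fun pre a post h => ?_).congr rfl rfl ?_ (forEachTime_mono (hs .row) le_rfl)
    · simp only [map_id, Store.update_row, Store.update_row']
      exact runsIn_emitOneAt tag (bounded_split_row hs h) ht .cnt' (!a.bit) .cnt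
    · simp [map_flatMap]
  refine (h.seq <| (runsIn_emitOneAt tag hs ht .cnt' false .cnt).seq <|
    (runsIn_emitOneAt tag hs ht .cnt' false .cnt).seq <|
    (runsIn_emitLen tag hs ht false .cyc).seq
    (runsIn_emitOneAt tag hs ht .cnt' false .cnt)).congr rfl rfl ?_ (by omega)
  simp [Store.get]

/-- Push the row of `diag e i` to the output stack. -/
def diagRow (e : Bool) : Prog Stack Letter :=
  (emitLen tag true .mat).seq <|
    (bif e then (emitLen tag true .cyc).seq (emitOneAt tag .cnt' false .cnt)
      else (emitOneAt tag .cnt' false .cnt).seq (emitLen tag true .cyc)).seq <|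
    (emitOneAt tag .cnt' false .cnt).seq (emitOneAt tag .cnt' false .cnt)

theorem runsIn_diagRow (e : Bool) (hs : s.Bounded B) (ht : s.tmp = []) :
    RunsIn (diagRow tag e) s.get s.get
      ((replicate s.mat.length true ++
        (bif e then replicate s.cyc.length true ++ oneAt s.cnt' false s.cnt
          else oneAt s.cnt' false s.cnt ++ replicate s.cyc.length true) ++
        oneAt s.cnt' false s.cnt ++ oneAt s.cnt' false s.cnt).map tag)
      (11 * emitTime B) := by
  have h₁ := runsIn_emitLen tag hs ht true .cyc
  have h₂ := runsIn_emitOneAt tag hs ht .cnt' false .cnt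
  have h : RunsIn (bif e then (emitLen tag true .cyc).seq (emitOneAt tag .cnt' false .cnt)
      else (emitOneAt tag .cnt' false .cnt).seq (emitLen tag true .cyc)) s.get s.get
      ((bif e then replicate s.cyc.length true ++ oneAt s.cnt' false s.cnt
          else oneAt s.cnt' false s.cnt ++ replicate s.cyc.length true).map tag)
      (4 * emitTime B) := by
    cases e
    · exact (h₂.seq h₁).congr rfl rfl (by simp [Store.get]) (by omega)
    · exact (h₁.seq h₂).congr rfl rfl (by simp [Store.get]) (by omega)
  refine ((runsIn_emitLen tag hs ht true .mat).seq <| h.seq <| h₂.seq h₂).congr rfl rfl ?_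
    (by omega)
  simp [Store.get]

/-! ### Loops over the rows of the matrix -/

/-- Move a row from the stack `mat` to the stack `row`. -/
def takeRow : Prog Stack Letter :=
  (forEach .cyc .cyc' fun _ => pop .mat skip (push .row')).seq (move .row' .row)

/-- The loop over `cyc` runs `r.length` times, and so it moves exactly the row `r`. -/
theorem runsIn_takeRow (hs : s.Bounded B) {r m : List Letter} (hm : s.mat = r ++ m)
    (hc : s.cyc = replicate r.length (.inl true)) (hc' : s.cyc' = []) (hr : s.row = [])
    (hr' : s.row' = []) :
    RunsIn takeRow s.get { s with mat := m, row := r }.get [] (forEachTime B 2 + (2 * B + 1)) := by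
  have hrB : r.length ≤ B := by
    have := hs .cyc
    rwa [Store.get, hc, length_replicate] at this
  have h₁ := runsIn_forEach (k := Stack.cyc) (k' := .cyc') (by decide)
    (f := fun _ => pop .mat skip (push .row')) (fun _ : Letter => Sum.inl true) r
    (fun pre post => { s with mat := post ++ m, row' := pre.reverse }.get) (fun _ => []) 2
    (fun pre a post h => by
      refine ((runsIn_push Stack.row' a).pop (l := post ++ m) (by simp [Store.get])).congr
        rfl ?_ rfl le_rfl
      simp [Store.get])
  have h₂ := h₁.seq (runsIn_move (k := Stack.row') (k' := .row) (by decide) _)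
  obtain ⟨_, _, _, _, _, _, _, _, _, _, _, _⟩ := s
  dsimp only at *
  subst hm hc hc' hr hr'
  refine h₂.congr ?_ ?_ (by simp) ?_
  · simp
  · simp [Store.get]
  · have := forEachTime_mono hrB (le_refl 2)
    simp [Store.get]
    omega

/-- Run the program `p` for each row of the matrix: the row is on the stack `row`, the other rows on
the stacks `mat'` and `mat`. -/
def forRows (p : Prog Stack Letter) : Prog Stack Letter :=
  (forEach .cnt .cnt' fun _ => takeRow.seq (p.seq (move .row .mat'))).seq (move .mat' .mat)

/-- A time bound for `forRows` if the body takes time `c`. -/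
def forRowsTime {R : Type*} [Semiring R] (B c : R) : R :=
  forEachTime B (forEachTime B 2 + (2 * B + 1) + (c + (2 * B + 1))) + (2 * B + 1)

/-- The stacks while the loop over the rows of the matrix is at the row `r i`. -/
def rowStore {ι : Type*} (s : Store) (r : ι → List Letter) (pre : List ι) (i : ι) (post : List ι) :
    Store :=
  { s with
    cnt := post.map fun _ => .inl true
    cnt' := (pre.map fun _ => .inl true).reverse
    mat := post.flatMap r
    mat' := (pre.flatMap r).reverse
    row := r i }

theorem bounded_rowStore {ι : Type*} {r : ι → List Letter} {L pre post : List ι} {i : ι}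
    (hs : s.Bounded B) (hm : s.mat = L.flatMap r) (hc : s.cnt = L.map fun _ => .inl true)
    (h : L = pre ++ i :: post) : (rowStore s r pre i post).Bounded B := by
  have h₁ := hs .mat
  have h₂ := hs .cnt
  intro k
  have h₃ := hs k
  cases k <;> simp [rowStore, Store.get, hm, hc, h] at h₁ h₂ h₃ ⊢ <;> omega

/-- The rule for `forRows`, for a matrix with the rows `r i` for `i` in a list `L`. -/
theorem runsIn_forRows {ι : Type*} {r : ι → List Letter} {L : List ι} {p : Prog Stack Letter}
    (out : ι → List Letter) {c : ℕ} (hs : s.Bounded B)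
    (hm : s.mat = L.flatMap r) (hc : s.cnt = L.map fun _ => .inl true)
    (hr : ∀ i, (r i).length = L.length) (hy : s.cyc = replicate L.length (.inl true))
    (hm' : s.mat' = []) (hc' : s.cnt' = []) (hy' : s.cyc' = []) (hrow : s.row = [])
    (hrow' : s.row' = [])
    (hp : ∀ pre i post, L = pre ++ i :: post →
      RunsIn p (rowStore s r pre i post).get (rowStore s r pre i post).get (out i) c) :
    RunsIn (forRows p) s.get s.get (L.flatMap out) (forRowsTime B c) := by
  have hLB : L.length ≤ B := by
    have := hs .cnt
    rwa [Store.get, hc, length_map] at this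
  have hLm : (L.flatMap r).length ≤ B := by
    have := hs .mat
    rwa [Store.get, hm] at this
  have h₁ := runsIn_forEach (k := Stack.cnt) (k' := .cnt') (by decide)
    (f := fun _ => takeRow.seq (p.seq (move .row .mat'))) (fun _ : ι => (Sum.inl true : Letter)) L
    (fun pre post => { s with mat := post.flatMap r, mat' := (pre.flatMap r).reverse }.get) out
    (forEachTime B 2 + (2 * B + 1) + (c + (2 * B + 1))) (fun pre i post h => by
      have hb := bounded_rowStore hs hm hc h
      have hb' : Store.Bounded { s with
          mat := (i :: post).flatMap r
          mat' := (pre.flatMap r).reverse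
          cnt := post.map fun _ => .inl true
          cnt' := (pre.map fun _ => .inl true).reverse } B := by
        intro k
        have h₁ := hb k
        rw [h] at hLm
        cases k <;> simp [rowStore, Store.get, hrow] at h₁ hLm ⊢ <;> omega
      have e₁ := runsIn_takeRow hb' (r := r i) (m := post.flatMap r) (by simp)
        (by rw [hr]; exact hy) hy' hrow hrow'
      have e₂ := runsIn_move (k := Stack.row) (k' := .mat') (by decide)
        (rowStore s r pre i post).get
      refine (e₁.seq ((hp pre i post h).seq e₂)).congr (by simp) ?_ (by simp) ?_
      · simp [rowStore, Store.get, hrow]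
      · have := hb .row
        omega)
  have h₂ := h₁.seq (runsIn_move (k := Stack.mat') (k' := .mat) (by decide) _)
  obtain ⟨_, _, _, _, _, _, _, _, _, _, _, _⟩ := s
  dsimp only at *
  subst hm hc hy hm' hc' hy' hrow hrow'
  refine h₂.congr ?_ ?_ (by simp) ?_
  · simp
  · simp [Store.get]
  · have := forEachTime_mono hLB (le_refl (forEachTime B 2 + (2 * B + 1) + (c + (2 * B + 1))))
    simp only [Store.update_cnt, Store.update_cnt', Store.get, forRowsTime, length_reverse]
    omega

/-! ### The adjacency matrix of the constructed graph -/

variable {n : ℕ} (G : SimpleGraph (Fin n))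

/-- A row of the adjacency matrix, as a string. -/
noncomputable def matrixRow (i : Fin n) : List Letter :=
  (finRange n).map fun j => .inl (entry G i j)

/-- The stacks when a graph has been read. -/
noncomputable def graphStore (x y : List Letter) : Store where
  input := []
  fst := x
  snd := y
  mat := (finRange n).flatMap (matrixRow G)
  mat' := []
  cnt := (finRange n).map fun _ => .inl true
  cnt' := []
  cyc := replicate (finRange n).length (.inl true)
  cyc' := []
  row := []
  row' := []
  tmp := []

variable {x y : List Letter}

theorem length_flatMap_matrixRow (l : List (Fin n)) :
    (l.flatMap (matrixRow G)).length = l.length * n := by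
  simp [length_flatMap, matrixRow]

theorem oneAt_congr {α β γ δ : Type*} {pre : List α} {pre' : List β} {post : List γ}
    {post' : List δ} (h : pre.length = pre'.length) (h' : post.length = post'.length) (b : Bool) :
    oneAt pre b post = oneAt pre' b post' := by
  rw [oneAt, oneAt, h, h']

theorem oneAt_cnt {pre post : List (Fin n)} (b : Bool) :
    oneAt (pre.map fun _ => (Sum.inl true : Letter)).reverse b
      (post.map fun _ => (Sum.inl true : Letter)) = oneAt pre b post :=
  oneAt_congr (by simp) (by simp) b

/-- Push the rows of all vertices `mid i l` to the output stack. -/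
def midRows : Prog Stack Letter := forRows (forEach .row .row' fun a => midRow tag a.bit)

theorem runsIn_midRows (hs : (graphStore G x y).Bounded B) :
    RunsIn (midRows tag) (graphStore G x y).get (graphStore G x y).get
      ((((finRange n).flatMap fun k => (finRange n).map (mid k)).flatMap fun u =>
        (verts n).map (entry (compGraph G)ᶜ u)).map tag)
      (forRowsTime B (forEachTime B (13 * emitTime B))) := by
  have hn : n ≤ B := by simpa [graphStore, Store.get] using hs .cnt
  refine (runsIn_forRows (r := matrixRow G) (L := finRange n) (fun i =>
    ((finRange n).flatMap fun l => (verts n).map (entry (compGraph G)ᶜ (mid i l))).map tag)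
    hs rfl rfl (by simp [matrixRow]) rfl rfl rfl rfl rfl rfl fun pre i post h => ?_).congr
    rfl rfl ?_ le_rfl
  · have hb := bounded_rowStore (r := matrixRow G) hs rfl rfl h
    refine (runsIn_forEach_const (k := .row) (k' := .row') (f := fun a => midRow tag a.bit)
      (by decide) (fun l => .inl (entry G i l)) (finRange n) _ rfl rfl
      (fun l => ((verts n).map (entry (compGraph G)ᶜ (mid i l))).map tag) (13 * emitTime B)
      fun pre' l post' h' => ?_).congr rfl rfl ?_ ?_
    · simp only [Store.update_row, Store.update_row']
      refine (runsIn_midRow tag (bounded_split_row hb (pre := pre'.map fun l => .inl (entry G i l))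
        (a := .inl (entry G i l)) ?_) rfl (entry G i l)).congr rfl rfl ?_ le_rfl
      · simp [rowStore, matrixRow, h']
      · have e (b : Bool) : oneAt (pre'.map fun l => (Sum.inl (entry G i l) : Letter)).reverse b
            (post'.map fun l => (Sum.inl (entry G i l) : Letter)) = oneAt pre' b post' :=
          oneAt_congr (by simp) (by simp) b
        rw [row_mid G h h']
        simp only [rowStore, graphStore, length_reverse, length_flatMap_matrixRow, oneAt_cnt,
          length_replicate, length_finRange]
        rw [e, e]
    · simp [map_flatMap]
    · exact forEachTime_mono (by simpa) le_rfl
  · simp [map_flatMap, flatMap_assoc, flatMap_map]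

/-- Push the rows of all vertices `low i` to the output stack. -/
def lowRows : Prog Stack Letter := forRows (lowRow tag)

theorem runsIn_lowRows (hs : (graphStore G x y).Bounded B) :
    RunsIn (lowRows tag) (graphStore G x y).get (graphStore G x y).get
      ((((finRange n).map low).flatMap fun u => (verts n).map (entry (compGraph G)ᶜ u)).map tag)
      (forRowsTime B (13 * emitTime B)) := by
  refine (runsIn_forRows (r := matrixRow G) (L := finRange n) (fun i =>
    ((verts n).map (entry (compGraph G)ᶜ (low i))).map tag)
    hs rfl rfl (by simp [matrixRow]) rfl rfl rfl rfl rfl rfl fun pre i post h => ?_).congr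
    rfl rfl (by simp [map_flatMap, flatMap_map]) le_rfl
  refine (runsIn_lowRow tag (bounded_rowStore (r := matrixRow G) hs rfl rfl h) rfl rfl).congr
    rfl rfl ?_ le_rfl
  rw [row_low G h]
  simp only [rowStore, graphStore, length_reverse, length_flatMap_matrixRow, oneAt_cnt,
    length_replicate, length_finRange, matrixRow, map_map]
  rfl

/-- Push the rows of all vertices `high i` to the output stack. -/
def highRows : Prog Stack Letter := forRows (highRow tag)

theorem runsIn_highRows (hs : (graphStore G x y).Bounded B) :
    RunsIn (highRows tag) (graphStore G x y).get (graphStore G x y).get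
      ((((finRange n).map high).flatMap fun u => (verts n).map (entry (compGraph G)ᶜ u)).map tag)
      (forRowsTime B (forEachTime B (3 * emitTime B) + 10 * emitTime B)) := by
  refine (runsIn_forRows (r := matrixRow G) (L := finRange n) (fun i =>
    ((verts n).map (entry (compGraph G)ᶜ (high i))).map tag)
    hs rfl rfl (by simp [matrixRow]) rfl rfl rfl rfl rfl rfl fun pre i post h => ?_).congr
    rfl rfl (by simp [map_flatMap, flatMap_map]) le_rfl
  refine (runsIn_highRow tag (bounded_rowStore (r := matrixRow G) hs rfl rfl h) rfl rfl).congr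
    rfl rfl ?_ le_rfl
  rw [row_high G h]
  simp only [rowStore, graphStore, oneAt_cnt, length_replicate, length_finRange, matrixRow,
    flatMap_map]
  rfl

/-- Push the rows of all vertices `diag e i` to the output stack. -/
def diagRows (e : Bool) : Prog Stack Letter := forEach .cnt .cnt' fun _ => diagRow tag e

theorem runsIn_diagRows (e : Bool) (hs : (graphStore G x y).Bounded B) :
    RunsIn (diagRows tag e) (graphStore G x y).get (graphStore G x y).get
      ((((finRange n).map (diag e)).flatMap fun u =>
        (verts n).map (entry (compGraph G)ᶜ u)).map tag)
      (forEachTime B (11 * emitTime B)) := by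
  have hn : n ≤ B := by simpa [graphStore, Store.get] using hs .cnt
  refine (runsIn_forEach_const (k := .cnt) (k' := .cnt') (f := fun _ => diagRow tag e)
    (by decide) (fun _ => .inl true) (finRange n) _ rfl rfl
    (fun i => ((verts n).map (entry (compGraph G)ᶜ (diag e i))).map tag) (11 * emitTime B)
    fun pre i post h => ?_).congr rfl rfl (by simp [map_flatMap, flatMap_map])
      (forEachTime_mono (by simpa) le_rfl)
  simp only [Store.update_cnt, Store.update_cnt']
  refine (runsIn_diagRow tag e ?_ rfl).congr rfl rfl ?_ le_rfl
  · intro k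
    have h₁ := hs k
    have h₂ : pre.length + (post.length + 1) ≤ B := by
      have := hs .cnt
      simpa [graphStore, Store.get, h] using this
    cases k <;> simp [graphStore, Store.get] at h₁ ⊢ <;> omega
  · rw [row_diag G e h]
    simp only [graphStore, length_flatMap_matrixRow, oneAt_cnt, length_replicate, length_finRange]

end Prog

namespace Prog

open List Vert

variable {B : ℕ} (tag : Bool → Letter)

/-! ### Reading the input -/

/-- Read the number of vertices. -/
def readSize : Prog Stack Letter :=
  loop .mat (fun a => !a.bit) fun a => (push .cnt a).seq (push .cyc a)

theorem runsIn_readSize (k : ℕ) (m : List Letter) (s : Store)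
    (hs : s.mat = replicate k (Sum.inl true) ++ Sum.inl false :: m) :
    RunsIn readSize s.get
      { s with
        mat := m
        cnt := replicate k (Sum.inl true) ++ s.cnt
        cyc := replicate k (Sum.inl true) ++ s.cyc }.get [] (3 * k + 1) := by
  induction k generalizing s with
  | zero =>
    have := Runs.loop_last (k := Stack.mat) (isLast := fun a : Letter => !a.bit)
      (f := fun a => (push .cnt a).seq (push .cyc a)) (S := s.get) (a := .inl false) (l := m) hs rfl
    rw [Store.update_mat] at this
    exact ⟨1, le_rfl, this⟩
  | succ k ih =>
    have h₁ := (runsIn_push (A := Letter) (S := { s with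
      mat := replicate k (Sum.inl true) ++ Sum.inl false :: m }.get) Stack.cnt (.inl true)).seq
        (runsIn_push Stack.cyc (.inl true))
    obtain ⟨t, ht, h⟩ := h₁
    obtain ⟨t', ht', h'⟩ := ih { s with
      mat := replicate k (Sum.inl true) ++ Sum.inl false :: m
      cnt := Sum.inl true :: s.cnt
      cyc := Sum.inl true :: s.cyc } rfl
    rw [Store.update_cnt, Store.update_cyc] at h
    have h₂ := Runs.loop_cons (k := Stack.mat) (S := s.get) (a := Sum.inl true)
      (isLast := fun a : Letter => !a.bit) (f := fun a => (push .cnt a).seq (push .cyc a))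
      (l := replicate k (Sum.inl true) ++ Sum.inl false :: m)
      (by rw [Store.get, hs, replicate_succ, cons_append]) rfl
      (by rw [Store.update_mat]; exact h) h'
    refine RunsIn.congr ⟨_, by omega, h₂⟩ rfl ?_ rfl le_rfl
    have (l : List Letter) : replicate k (Sum.inl true) ++ Sum.inl true :: l =
        replicate (k + 1) (Sum.inl true) ++ l := by
      rw [replicate_succ', append_assoc, singleton_append]
    simp only [this]

/-- Read a graph from the stack `mat`, and push the string that describes the constructed graph
to the output stack, backwards. -/
def graphProg : Prog Stack Letter :=
  readSize.seq <| (midRows tag).seq <| (diagRows tag false).seq <| (diagRows tag true).seq <|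
    (lowRows tag).seq <| (highRows tag).seq <| (emit (tag false)).seq <|
    (emitLen tag true .mat).seq <| (emitLen tag true .cyc).seq <| (emitLen tag true .cyc).seq <|
    (emitLen tag true .cyc).seq <| (emitLen tag true .cyc).seq <|
    (clear .mat).seq <| (clear .cnt).seq (clear .cyc)

/-- A time bound for `graphProg`. -/
def graphTime {R : Type*} [Semiring R] (B : R) : R :=
  3 * B + 1 + forRowsTime B (forEachTime B (13 * emitTime B)) +
    2 * forEachTime B (11 * emitTime B) + forRowsTime B (13 * emitTime B) +
    forRowsTime B (forEachTime B (3 * emitTime B) + 10 * emitTime B) + 1 + 5 * emitTime B +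
    3 * (2 * B + 1)

/-- The stacks when only the strings of the graphs are present. -/
def stringStore (i x y m : List Letter) : Store where
  input := i
  fst := x
  snd := y
  mat := m
  mat' := []
  cnt := []
  cnt' := []
  cyc := []
  cyc' := []
  row := []
  row' := []
  tmp := []

theorem runsIn_graphProg (G : FinGraph) {x y : List Letter}
    (hB : (stringStore [] x y ((encodeGraph G).map .inl)).Bounded B) :
    RunsIn (graphProg tag) (stringStore [] x y ((encodeGraph G).map .inl)).get
      (stringStore [] x y []).get ((encodeGraph (trapGraph G)).reverse.map tag) (graphTime B) := by
  obtain ⟨n, G⟩ := G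
  have hm := hB .mat
  simp only [Store.get, stringStore, length_map] at hm
  have hlen : n + (n * n + 1) ≤ B := by
    rw [encodeGraph_eq] at hm
    simpa [length_flatMap] using hm
  have e₁ : RunsIn readSize (stringStore [] x y ((encodeGraph ⟨n, G⟩).map .inl)).get
      (graphStore G x y).get [] (3 * B + 1) := by
    refine (runsIn_readSize n ((finRange n).flatMap (matrixRow G)) _ ?_).congr rfl ?_ rfl (by omega)
    · simp only [stringStore, encodeGraph_eq, map_append, map_replicate, map_cons, map_flatMap,
        map_map]
      rfl
    · simp [stringStore, graphStore]
  have hs : (graphStore G x y).Bounded B := by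
    intro k
    have h := hB k
    have h' := length_flatMap_matrixRow G (finRange n)
    cases k <;> simp [graphStore, stringStore, Store.get] at h h' ⊢ <;> omega
  -- `mat` has `n * n` letters and `cyc` has `n`, which gives the number of vertices in unary
  have em := runsIn_emitLen tag hs rfl true .mat
  have ec := runsIn_emitLen tag hs rfl true .cyc
  have c₁ := runsIn_clear .mat (graphStore G x y).get
  have c₂ := runsIn_clear .cnt { graphStore G x y with mat := [] }.get
  have c₃ := runsIn_clear .cyc { graphStore G x y with mat := [], cnt := [] }.get
  rw [Store.update_mat] at c₁
  rw [Store.update_cnt] at c₂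
  refine (e₁.seq <| (runsIn_midRows tag G hs).seq <| (runsIn_diagRows tag G false hs).seq <|
    (runsIn_diagRows tag G true hs).seq <| (runsIn_lowRows tag G hs).seq <|
    (runsIn_highRows tag G hs).seq <| (runsIn_emit (tag false)).seq <|
    em.seq <| ec.seq <| ec.seq <| ec.seq <| ec.seq <| c₁.seq <| c₂.seq c₃).congr rfl ?_ ?_ ?_
  · rw [Store.update_cyc]
    rfl
  · have e (f : Vert n → List Bool) : (verts n).flatMap f =
        ((finRange n).flatMap fun k => (finRange n).map (mid k)).flatMap f ++
          ((finRange n).map (diag false)).flatMap f ++ ((finRange n).map (diag true)).flatMap f ++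
          ((finRange n).map low).flatMap f ++ ((finRange n).map high).flatMap f := by
      simp only [verts, flatMap_append]
    have hlen := length_flatMap_matrixRow G (finRange n)
    rw [length_finRange] at hlen
    rw [reverse_encodeGraph_trapGraph, e]
    simp only [map_append, map_cons, replicate_add, append_assoc, nil_append, append_nil,
      cons_append, Store.get, graphStore, hlen, length_replicate, length_finRange]
  · have h₁ := hs .mat
    have h₂ := hs .cnt
    have h₃ := hs .cyc
    simp only [Store.get] at h₁ h₂ h₃ ⊢
    unfold graphTime
    omega

/-- Separate the strings of the two graphs. -/
def splitInput : Prog Stack Letter :=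
  loop .input (fun _ => false)
    (Sum.elim (fun b => push .fst (Sum.inl b)) fun b => push .snd (Sum.inl b))

/-- The program for the reduction. It treats the second graph first, because the output string is
built from its end. -/
def reduction : Prog Stack Letter :=
  splitInput.seq <| (move .snd .mat).seq <| (graphProg .inr).seq <|
    (move .fst .mat).seq (graphProg .inl)

/-- A time bound for `reduction`. -/
def reductionTime {R : Type*} [Semiring R] (B : R) : R :=
  2 * B + 1 + 2 * (2 * B + 1) + 2 * graphTime B

theorem runsIn_splitInput (l m : List Bool) :
    RunsIn splitInput
      (stringStore (l.map Sum.inl ++ m.map Sum.inr) [] [] []).get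
      (stringStore [] (l.map Sum.inl).reverse (m.map Sum.inl).reverse []).get []
      (2 * (l.map Sum.inl ++ m.map Sum.inr : List Letter).length + 1) := by
  have h := runsIn_loop (k := Stack.input) (isLast := fun _ => false)
    (f := (Sum.elim (fun b => push .fst (Sum.inl b)) fun b => push .snd (Sum.inl b) :
      Letter → Prog Stack Letter)) id (l.map Sum.inl ++ m.map Sum.inr)
    (fun pre post => (stringStore post ((pre.filterMap Sum.getLeft?).map Sum.inl).reverse
      ((pre.filterMap Sum.getRight?).map Sum.inl).reverse []).get) (fun _ => []) 1
    (fun _ _ => rfl) (fun pre post h => by simp [stringStore, Store.get])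
    (fun pre a post h => by
      rcases a with b | b
      · refine (runsIn_push Stack.fst (Sum.inl b)).congr rfl ?_ rfl le_rfl
        simp [stringStore, Store.get]
        rfl
      · refine (runsIn_push Stack.snd (Sum.inl b)).congr rfl ?_ rfl le_rfl
        simp [stringStore, Store.get]
        rfl)
  refine h.congr rfl ?_ (by simp) (by omega)
  simp [Function.comp_def, filterMap_map]

theorem runsIn_reduction (p : FinGraph × FinGraph) :
    RunsIn reduction (stringStore (encodePair p) [] [] []).get (stringStore [] [] [] []).get
      (encodePair (trapGraph p.1, trapGraph p.2)).reverse
      (reductionTime (encodePair p).length) := by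
  obtain ⟨G, H⟩ := p
  set B := (encodePair (G, H)).length with hB
  have hB' : B = (encodeGraph G).length + (encodeGraph H).length := by simp [hB, encodePair]
  have e₁ := runsIn_splitInput (encodeGraph G) (encodeGraph H)
  have e₂ := runsIn_move (k := Stack.snd) (k' := .mat) (by decide)
    (stringStore [] ((encodeGraph G).map Sum.inl).reverse
      ((encodeGraph H).map Sum.inl).reverse []).get
  have e₃ := runsIn_graphProg .inr H (x := ((encodeGraph G).map Sum.inl).reverse) (y := []) (B := B)
    (by intro k; cases k <;> simp [stringStore, Store.get, hB'])
  have e₄ := runsIn_move (k := Stack.fst) (k' := .mat) (by decide)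
    (stringStore [] ((encodeGraph G).map Sum.inl).reverse [] []).get
  have e₅ := runsIn_graphProg .inl G (x := []) (y := []) (B := B)
    (by intro k; cases k <;> simp [stringStore, Store.get, hB'])
  have e₂' := e₂.congr (S₁' := (stringStore [] ((encodeGraph G).map Sum.inl).reverse []
    ((encodeGraph H).map Sum.inl)).get) rfl (by simp [stringStore, Store.get]) rfl le_rfl
  have e₄' := e₄.congr (S₁' := (stringStore [] [] [] ((encodeGraph G).map Sum.inl)).get) rfl
    (by simp [stringStore, Store.get]) rfl le_rfl
  refine (e₁.seq <| e₂'.seq <| e₃.seq <| e₄'.seq e₅).congr rfl rfl ?_ ?_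
  · simp [encodePair]
  · simp only [stringStore, Store.get, length_append, length_map, length_reverse, reductionTime]
    omega

/-- The time bound, written for the variable `X`, is a polynomial. -/
theorem eval_reductionTime (m : ℕ) :
    (reductionTime (Polynomial.X : Polynomial ℕ)).eval m = reductionTime m := by
  simp [reductionTime, graphTime, forRowsTime, forEachTime, emitTime]

end Prog

/-! ### The two reductions -/

open Prog Vert

/-- The problem for a class of graphs reduces to the problem for all graphs. -/
theorem polyTimeReducible_univ (C : Set FinGraph) :
    PolyTimeReducible (graphIsomorphismProblem C) (graphIsomorphismProblem Set.univ) := by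
  refine ⟨fun p => ⟨p.1, trivial, trivial⟩, ⟨?_⟩, fun p => Iff.rfl⟩
  exact
    { tm := Turing.idComputer (Bool ⊕ Bool)
      inputAlphabet := Equiv.refl _
      outputAlphabet := Equiv.refl _
      time := 1
      outputsFun := fun p =>
        { steps := 1
          evals_in_steps := rfl
          steps_le_m := by simp } }

/-- The problem for all graphs reduces to the problem for trapezoid graphs. -/
theorem polyTimeReducible_trapezoid :
    PolyTimeReducible (graphIsomorphismProblem Set.univ)
      (graphIsomorphismProblem {G : FinGraph | IsTrapezoidGraph G.2}) := by
  refine ⟨fun p => ⟨(trapGraph p.1.1, trapGraph p.1.2),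
    isTrapezoidGraph_trapGraph _, isTrapezoidGraph_trapGraph _⟩, ⟨?_⟩,
    fun p => (nonempty_iso_trapGraph_iff p.1.1 p.1.2).symm⟩
  refine
    { tm := machine reduction .input
      inputAlphabet := Equiv.refl _
      outputAlphabet := Equiv.refl _
      time := reductionTime Polynomial.X + 1
      outputsFun := fun p => ?_ }
  have h := runsIn_reduction p.1
  have e₁ : (stringStore (encodePair p.1) [] [] []).get =
      Function.update (fun _ => []) .input (encodePair p.1) := by
    funext k; cases k <;> rfl
  have e₂ : (stringStore [] [] [] []).get = fun _ => [] := by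
    funext k; cases k <;> rfl
  rw [e₁, e₂] at h
  have ht := h.choose_spec.1
  have hr := h.choose_spec.2.outputsInTime (Nat.succ_le_succ ht)
  rw [List.reverse_reverse] at hr
  rw [Polynomial.eval_add, eval_reductionTime, Polynomial.eval_one]
  have key {l l' o o' : List Letter} {T : ℕ} (hl : l' = l) (ho : o' = o)
      (h : Turing.TM2OutputsInTime (machine reduction .input) l (some o) T) :
      Turing.TM2OutputsInTime (machine reduction .input) l' (some o') T := by
    subst hl ho
    exact h
  exact key (List.map_id _) (List.map_id _) hr

theorem mainTheorem2 : GIComplete {G : FinGraph | IsTrapezoidGraph G.2} :=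
  ⟨polyTimeReducible_univ _, polyTimeReducible_trapezoid⟩
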